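/- Let $F$ be a field of characteristic $2$. A totally singular quadratic form over $F$ is a map $\varphi\colon V\to F$ on a finite-dimensional $F$-vector space $V$ with $\varphi(v+w)=\varphi(v)+\varphi(w)$ and $\varphi(av)=a^2\varphi(v)$; put $\dim\varphi=\dim_F V$. Isometry $\simeq$ and subforms $\subseteq$ are given by bijective, respectively injective, $F$-linear maps preserving the values; $\langle a_1,\dots,a_n\rangle$ is the form $\sum a_ix_i^2$ on $F^n$; $\varphi$ and $\psi$ are similar if $\varphi\simeq c\psi$ for some $c\in F^*$. Every form can be written as $\varphi\simeq\varphi_{\mathrm{an}}\perp k\times\langle 0\rangle$ with $\varphi_{\mathrm{an}}$ anisotropic (its anisotropic part, unique up to isometry) and $k\ge 0$ (its defect). For a field extension $E/F$, $\varphi_E$ is the form on $E\otimes_F V$ with $\varphi_E(e\otimes v)=e^2\varphi(v)$. Two forms $\varphi,\psi$ over $F$ are Vishik equivalent if $\dim\varphi=\dim\psi$ and $\varphi_E$ and $\psi_E$ have the same defect for every field extension $E/F$. Let $G_F(\varphi)=\{x\in F^*\mid x\varphi\simeq\varphi\}\cup\{0\}$. A quasi-Pfister form is a form isometric to $\langle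 1,a_1\rangle\otimes\cdots\otimes\langle 1,a_n\rangle$ with $n\ge 0$ and $a_i\in F$ (it is $\langle 1\rangle$ for $n=0$). A form $\varphi$ is a quasi-Pfister neighbor of codimension $k$ if there are a quasi-Pfister form $\pi$ and $c\in F^*$ such that $c\varphi\subseteq\pi$, $\dim\varphi>\frac12\dim\pi$ and $\dim\pi-\dim\varphi=k$. A form $\varphi$ is minimal if it is anisotropic and $[N_F(\varphi):F^2]=2^{\dim\varphi-1}$, where $N_F(\varphi)=F^2\bigl(\tfrac ab \mid a,b \text{ nonzero values of }\varphi\bigr)$. A form $\varphi$ is a special quasi-Pfister neighbor given by the triple $(\pi,b,\sigma)$ if $\pi$ is a quasi-Pfister form, $b\in F^*$, $\sigma\subseteq\pi$, and $\varphi$ is similar to $\pi\perp b\sigma$. Let $\varphi,\psi$ be Vishik equivalent totally singular quadratic forms over $F$, and let $K/F$ be a field extension such that $K^2=G_F(\varphi)$ (as subsets of $K$). Assume that $(\varphi_K)_{\mathrm{an}}$ is a special quasi-Pfister neighbor given by a triple $(\pi,b,\sigma)$ over $K$, and that $c\pi\subseteq\psi_K$ for some $c\in K^*$. Suppose moreover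 that $\sigma$ is a quasi-Pfister form, or a quasi-Pfister neighbor of codimension one, or a minimal form over $K$. Then $\varphi$ and $\psi$ are similar over $F$. -/

import Mathlib

open scoped TensorProduct

universe u v w x y z

/-- A totally singular quadratic form over a field `F` of characteristic `2` on the `F`-vector
space `V`: an additive map `φ : V → F` with `φ (a • v) = a ^ 2 * φ v`, i.e. a map which is
semilinear with respect to the Frobenius `a ↦ a ^ 2`. Its dimension is `Module.finrank F V`. -/
abbrev TSForm (F : Type u) [Field F] [CharP F 2] (V : Type v) [AddCommGroup V] [Module F V] :
    Type (max u v) :=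
  V →ₛₗ[frobenius F 2] F

namespace TSForm

section Basic

variable {F : Type u} [Field F] [CharP F 2]
variable {V : Type v} [AddCommGroup V] [Module F V]
variable {W : Type w} [AddCommGroup W] [Module F W]

theorem apply_smul (φ : TSForm F V) (a : F) (v : V) : φ (a • v) = a ^ 2 * φ v := by
  rw [map_smulₛₗ, frobenius_def, smul_eq_mul]

/-- `φ ≃ ψ`. -/
def Isometric (φ : TSForm F V) (ψ : TSForm F W) : Prop :=
  ∃ f : V ≃ₗ[F] W, ∀ v, φ v = ψ (f v)

/-- `φ ⊆ ψ`. -/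
def IsSubform (φ : TSForm F V) (ψ : TSForm F W) : Prop :=
  ∃ f : V →ₗ[F] W, Function.Injective f ∧ ∀ v, φ v = ψ (f v)

/-- `φ ≃ c ψ` for some nonzero scalar `c`. -/
def Similar (φ : TSForm F V) (ψ : TSForm F W) : Prop :=
  ∃ c : F, c ≠ 0 ∧ Isometric φ (c • ψ)

/-- The orthogonal sum `φ ⊥ ψ` on `V × W`. -/
def orthSum (φ : TSForm F V) (ψ : TSForm F W) : TSForm F (V × W) where
  toFun z := φ z.1 + ψ z.2
  map_add' z z' := by
    simp only [Prod.fst_add, Prod.snd_add, map_add]; ring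
  map_smul' a z := by
    simp only [Prod.smul_fst, Prod.smul_snd, apply_smul, frobenius_def, smul_eq_mul]; ring

/-- The diagonal form `⟨a i : i ∈ ι⟩`, that is `x ↦ ∑ i, a i * x i ^ 2`. -/
def diag {ι : Type w} [Fintype ι] (a : ι → F) : TSForm F (ι → F) where
  toFun z := ∑ i, a i * z i ^ 2
  map_add' z z' := by
    rw [← Finset.sum_add_distrib]
    refine Finset.sum_congr rfl fun i _ => ?_
    rw [Pi.add_apply, CharTwo.add_sq, mul_add]
  map_smul' c z := by
    rw [smul_eq_mul, frobenius_def, Finset.mul_sum]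
    refine Finset.sum_congr rfl fun i _ => ?_
    rw [Pi.smul_apply, smul_eq_mul]; ring

/-- `φ v = 0` only for `v = 0`. -/
def Anisotropic (φ : TSForm F V) : Prop := ∀ v, φ v = 0 → v = 0

/-- The defect of `φ`: the dimension of the subspace of the isotropic vectors (with `0`).
See `isometric_anisotropicPart_orthSum` and `eq_of_isometric_orthSum`. -/
noncomputable def defect (φ : TSForm F V) : ℕ := Module.finrank F (LinearMap.ker φ)

/-- The anisotropic part of `φ`, realized as the form that `φ` induces on the quotient of `V` by
the subspace of isotropic vectors.
See `isometric_anisotropicPart_orthSum` and `eq_of_isometric_orthSum`. -/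
def anisotropicPart (φ : TSForm F V) : TSForm F (V ⧸ LinearMap.ker φ) :=
  (LinearMap.ker φ).liftQ φ le_rfl

theorem anisotropic_anisotropicPart (φ : TSForm F V) : φ.anisotropicPart.Anisotropic := by
  intro z hz
  obtain ⟨v, rfl⟩ := Submodule.mkQ_surjective _ z
  rw [Submodule.mkQ_apply, Submodule.Quotient.mk_eq_zero]
  exact hz

/-- `φ ≃ φ_an ⊥ k × ⟨0⟩`, where `k` is the defect of `φ`. -/
theorem isometric_anisotropicPart_orthSum [FiniteDimensional F V] (φ : TSForm F V) :
    Isometric φ (orthSum φ.anisotropicPart (diag (fun _ : Fin φ.defect => (0 : F)))) := by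
  obtain ⟨C, hC⟩ := Submodule.exists_isCompl (LinearMap.ker φ)
  let e₁ := Submodule.quotientEquivOfIsCompl _ C hC
  let e₂ : LinearMap.ker φ ≃ₗ[F] (Fin φ.defect → F) :=
    LinearEquiv.ofFinrankEq _ _ (Module.finrank_fin_fun F).symm
  let e₃ := (LinearEquiv.prodComm F _ _).trans (Submodule.prodEquivOfIsCompl _ C hC)
  refine ⟨e₃.symm.trans (e₁.symm.prodCongr e₂), fun v => ?_⟩
  obtain ⟨⟨c, k⟩, rfl⟩ := e₃.surjective v
  have hk : φ (k : V) = 0 := k.2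
  have hc : e₁.symm c = Submodule.Quotient.mk (c : V) :=
    Submodule.quotientEquivOfIsCompl_symm_apply _ _ _ _
  have h₁ : φ (e₃ (c, k)) = φ (c : V) := by
    simp [e₃, hk]
  rw [h₁]
  simp [orthSum, diag, hc, anisotropicPart]

/-- The decomposition of `φ` as an anisotropic form plus `k × ⟨0⟩` is unique. -/
theorem eq_of_isometric_orthSum [FiniteDimensional F V] (φ : TSForm F V)
    (τ : TSForm F W) (hτ : τ.Anisotropic) (k : ℕ)
    (h : Isometric φ (orthSum τ (diag (fun _ : Fin k => (0 : F))))) :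
    Isometric τ φ.anisotropicPart ∧ k = φ.defect := by
  obtain ⟨f, hf⟩ := h
  have hf' : ∀ v, φ v = τ (f v).1 := fun v => by simp [hf v, orthSum, diag]
  have hker : ∀ v, v ∈ LinearMap.ker φ ↔ (f v).1 = 0 := fun v => by
    rw [LinearMap.mem_ker, hf' v]
    exact ⟨hτ _, fun h => by rw [h, map_zero]⟩
  let g : V →ₗ[F] W := (LinearMap.fst F W (Fin k → F)).comp f.toLinearMap
  have hg : LinearMap.ker g = LinearMap.ker φ := by
    ext v; rw [hker v]; rfl
  have hsurj : Function.Surjective g := fun t => ⟨f.symm (t, 0), by simp [g]⟩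
  let e : (V ⧸ LinearMap.ker φ) ≃ₗ[F] W :=
    (Submodule.quotEquivOfEq _ _ hg.symm).trans (g.quotKerEquivOfSurjective hsurj)
  refine ⟨⟨e.symm, fun t => ?_⟩, ?_⟩
  · obtain ⟨z, rfl⟩ := e.surjective t
    obtain ⟨v, rfl⟩ := Submodule.mkQ_surjective _ z
    rw [LinearEquiv.symm_apply_apply]
    exact (hf' v).symm
  · have h₁ := (LinearMap.ker φ).finrank_quotient_add_finrank
    have h₂ := e.finrank_eq
    have : FiniteDimensional F W := e.finiteDimensional
    have h₃ := f.finrank_eq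
    rw [Module.finrank_prod, Module.finrank_fin_fun] at h₃
    unfold defect
    omega

/-- `D_F(φ) \ {0}`. -/
def nonzeroValues (φ : TSForm F V) : Set F := Set.range φ \ {0}

/-- `G_F(φ) = {x ∈ F \ {0} | x φ ≃ φ} ∪ {0}`. -/
def similarityFactors (φ : TSForm F V) : Set F :=
  {c : F | c ≠ 0 ∧ Isometric (c • φ) φ} ∪ {0}

/-- The norm field `N_F(φ) = F²(a / b | a, b ∈ D_F(φ) \ {0})`, as an extension of `F²`. -/
def normField (φ : TSForm F V) : IntermediateField (frobenius F 2).fieldRange F :=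
  IntermediateField.adjoin (frobenius F 2).fieldRange
    {c : F | ∃ a ∈ φ.nonzeroValues, ∃ b ∈ φ.nonzeroValues, c = a / b}

/-- The norm degree `[N_F(φ) : F²]`. -/
noncomputable def normDegree (φ : TSForm F V) : ℕ :=
  Module.finrank (frobenius F 2).fieldRange φ.normField

/-- `φ` is anisotropic and its norm degree is `2 ^ (dim φ - 1)`; the equation is doubled, so that
the zero-dimensional form is not minimal. -/
def IsMinimal (φ : TSForm F V) : Prop :=
  φ.Anisotropic ∧ 2 * φ.normDegree = 2 ^ Module.finrank F V

/-- The quasi-Pfister form `⟨⟨a₁, …, aₙ⟩⟩ = ⟨1, a₁⟩ ⊗ ⋯ ⊗ ⟨1, aₙ⟩`, that is the diagonal form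
whose entries are the `2 ^ n` products `a₁ ^ ε₁ ⋯ aₙ ^ εₙ` with `εᵢ ∈ {0, 1}`. It is `⟨1⟩` for
`n = 0`. -/
def pfister {n : ℕ} (a : Fin n → F) : TSForm F ((Fin n → Fin 2) → F) :=
  diag (fun ε : Fin n → Fin 2 => ∏ i, a i ^ (ε i : ℕ))

/-- `φ ≃ ⟨⟨a₁, …, aₙ⟩⟩` for some `n ≥ 0` and `a₁, …, aₙ ∈ F`. -/
def IsQuasiPfister (φ : TSForm F V) : Prop :=
  ∃ (n : ℕ) (a : Fin n → F), Isometric φ (pfister a)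

/-- `φ` is a quasi-Pfister neighbor of codimension `k`: `c φ ⊆ π` for some `c ≠ 0` and some
quasi-Pfister form `π` (of dimension `2 ^ n`) with `dim φ > dim π / 2` and
`dim π - dim φ = k`. -/
def IsQuasiPfisterNeighborOfCodim (φ : TSForm F V) (k : ℕ) : Prop :=
  ∃ (n : ℕ) (a : Fin n → F) (c : F), c ≠ 0 ∧ IsSubform (c • φ) (pfister a) ∧
    2 ^ n < 2 * Module.finrank F V ∧ Module.finrank F V + k = 2 ^ n

end Basic

/-- `φ` is a special quasi-Pfister neighbor given by the triple `(π, b, σ)`: `φ` is similar to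
`π ⊥ b σ`, where `π` is a quasi-Pfister form, `b ≠ 0` and `σ ⊆ π`. -/
def IsSpecialQuasiPfisterNeighbor {F : Type u} [Field F] [CharP F 2]
    {V : Type v} [AddCommGroup V] [Module F V] {P : Type w} [AddCommGroup P] [Module F P]
    {S : Type x} [AddCommGroup S] [Module F S]
    (φ : TSForm F V) (π : TSForm F P) (b : F) (σ : TSForm F S) : Prop :=
  IsQuasiPfister π ∧ b ≠ 0 ∧ IsSubform σ π ∧ Similar φ (orthSum π (b • σ))

section BaseChange

variable {F : Type u} [Field F] [CharP F 2]
variable {V : Type v} [AddCommGroup V] [Module F V]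

/-- The additive map `E ⊗ V → E`, `e ⊗ v ↦ e ^ 2 φ(v)`. -/
noncomputable def baseChangeAddHom (φ : TSForm F V) (E : Type w) [Field E] [Algebra F E]
    [CharP E 2] : E ⊗[F] V →+ E :=
  TensorProduct.liftAddHom
    (AddMonoidHom.mk' (fun e => AddMonoidHom.mk' (fun v => e ^ 2 * algebraMap F E (φ v))
        (fun v v' => by rw [map_add, map_add, mul_add]))
      (fun e e' => by
        ext v
        simp only [AddMonoidHom.mk'_apply, AddMonoidHom.add_apply]
        rw [CharTwo.add_sq, add_mul]))
    (fun a e v => by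
      simp only [AddMonoidHom.mk'_apply, apply_smul, Algebra.smul_def, map_mul, map_pow]
      ring)

/-- The form `φ_E` on `E ⊗ V`, with `φ_E (e ⊗ v) = e ^ 2 φ(v)`. -/
noncomputable def baseChange (φ : TSForm F V) (E : Type w) [Field E] [Algebra F E] [CharP E 2] :
    TSForm E (E ⊗[F] V) where
  toFun := φ.baseChangeAddHom E
  map_add' := map_add _
  map_smul' a z := by
    rw [frobenius_def, smul_eq_mul]
    induction z with
    | zero => simp
    | add z z' hz hz' => rw [smul_add, map_add, map_add, hz, hz', mul_add]
    | tmul e v =>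
      rw [TensorProduct.smul_tmul', smul_eq_mul]
      simp only [baseChangeAddHom, TensorProduct.liftAddHom_tmul, AddMonoidHom.mk'_apply]
      ring

theorem baseChange_tmul (φ : TSForm F V) (E : Type w) [Field E] [Algebra F E] [CharP E 2]
    (e : E) (v : V) : φ.baseChange E (e ⊗ₜ[F] v) = e ^ 2 * algebraMap F E (φ v) := rfl

/-- Vishik equivalence: `φ` and `ψ` have the same dimension, and `φ_E` and `ψ_E` have the same
defect for every field extension `E / F`. -/
def VishikEquivalent {W : Type w} [AddCommGroup W] [Module F W]
    (φ : TSForm F V) (ψ : TSForm F W) : Prop :=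
  Module.finrank F V = Module.finrank F W ∧
    ∀ (E : Type u) [Field E] [Algebra F E] [CharP E 2],
      (φ.baseChange E).defect = (ψ.baseChange E).defect

end BaseChange

end TSForm

/-! Everything is read off from sets of values. The values of a totally singular form over K form a
K²-subspace of K, and this subspace together with the dimension determines the form up to isometry
(`isometric_of_valueSpace_eq`). For K ⊆ E ⊆ K^(1/2), squaring identifies E with a field M between K²
and K, and the defect of φ_E is dim φ minus the M-dimension of the M-span of the values of φ_K
(`finrank_eq_defect_baseChange_add`). So for A = D(φ_K) and B = D(ψ_K), Vishik equivalence yields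
dim_M(MA) = dim_M(MB) for all such M.

After scaling, A = P + bS with a field P = D(π), a subspace S = D(σ) of P, b ∉ P, and P ⊆ B. The
field M = P(b) forces B = P + bS' with S' ⊆ P, and the fields M ≤ P force S and S' to have M-spans
of equal dimension (`exists_eq_sup_map_mulLeft`). It suffices to find p with pS = S': then p ∈ P, so
pA = P + bS' = B.

If S fills a field Q, or misses one dimension of it, up to scaling, such a p comes from a dimension
count (`exists_map_mulLeft_eq_of_codim_le_one`). If σ is minimal, then S is spanned by 1 and
independent square roots, up to scaling. Each x in S has a multiplier p with p, xp ∈ S', unique up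
to k(x)*; comparing the multipliers of several elements yields one that works for all of S
(`exists_map_mulLeft_eq_of_minimal`).

Finally, K² = G_F(φ) means that φ gains no values over K, which brings the scalar down to F
(`VishikEquivalent.similar_of_baseChange`). -/

section

open Module Submodule

/-! ### Extensions K/k with K² ⊆ k: generated fields and spans over intermediate fields -/

section SquareRoots

variable {k K : Type*} [Field k] [Field K] [Algebra k K]

theorem Subalgebra.inv_mem_of_sq (hsq : ∀ x : K, ∃ y : k, algebraMap k K y = x ^ 2)
    (A : Subalgebra k K) (x : K) (hx : x ∈ A) : x⁻¹ ∈ A := by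
  obtain ⟨y, hy⟩ := hsq x
  by_cases h0 : x = 0
  · simp [h0]
  have : x⁻¹ = y⁻¹ • x := by
    rw [Algebra.smul_def, map_inv₀, hy]; field_simp
  rw [this]
  exact A.smul_mem hx _

theorem mul_mem_span_prod (hsq : ∀ x : K, ∃ y : k, algebraMap k K y = x ^ 2) {n : ℕ}
    (a : Fin n → K) (i : Fin n) {x : K}
    (hx : x ∈ span k (Set.range fun ε : Fin n → Fin 2 => ∏ i, a i ^ (ε i : ℕ))) :
    a i * x ∈ span k (Set.range fun ε : Fin n → Fin 2 => ∏ i, a i ^ (ε i : ℕ)) := by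
  induction hx using span_induction with
  | zero => simp
  | add x y _ _ hx hy => rw [mul_add]; exact add_mem hx hy
  | smul c x _ hx => rw [mul_smul_comm]; exact smul_mem _ _ hx
  | mem x hx =>
    obtain ⟨ε, rfl⟩ := hx
    have key : ∀ δ : Fin 2, ∏ j, a j ^ (Function.update ε i δ j : ℕ) =
        a i ^ (δ : ℕ) * ∏ j ∈ Finset.univ.erase i, a j ^ (ε j : ℕ) := fun δ => by
      rw [← Finset.mul_prod_erase _ _ (Finset.mem_univ i), Function.update_self]
      congr 1
      refine Finset.prod_congr rfl fun j hj => ?_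
      rw [Function.update_of_ne (Finset.ne_of_mem_erase hj)]
    have h := Finset.mul_prod_erase Finset.univ (fun j => a j ^ (ε j : ℕ)) (Finset.mem_univ i)
    dsimp only at h ⊢
    rw [← h]
    rcases (by lia : ε i = 0 ∨ ε i = 1) with h0 | h0
    · refine subset_span ⟨Function.update ε i 1, ?_⟩
      dsimp only
      rw [key, h0]; simp
    · obtain ⟨y, hy⟩ := hsq (a i)
      have : a i * (a i ^ (ε i : ℕ) * ∏ j ∈ Finset.univ.erase i, a j ^ (ε j : ℕ)) =
          y • ∏ j, a j ^ (Function.update ε i 0 j : ℕ) := by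
        rw [key, h0, Algebra.smul_def, hy]; simp; ring
      rw [this]
      exact smul_mem _ _ (subset_span ⟨_, rfl⟩)

/-- The products of the `a i` span an intermediate field. -/
theorem exists_intermediateField_eq_span
    (hsq : ∀ x : K, ∃ y : k, algebraMap k K y = x ^ 2) {n : ℕ} (a : Fin n → K) :
    ∃ Q : IntermediateField k K, Subalgebra.toSubmodule Q.toSubalgebra =
      span k (Set.range fun ε : Fin n → Fin 2 => ∏ i, a i ^ (ε i : ℕ)) := by
  set R := span k (Set.range fun ε : Fin n → Fin 2 => ∏ i, a i ^ (ε i : ℕ)) with hR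
  have h1 : (1 : K) ∈ R := subset_span ⟨0, by simp⟩
  -- `A` is the multiplier ring of `R`. It lies in `R` because `1 ∈ R`, and it contains each `a i`,
  -- hence all their products.
  let A : Subalgebra k K :=
    { carrier := {x | ∀ y ∈ R, x * y ∈ R}
      mul_mem' := fun {x x'} hx hx' y hy => by
        rw [mul_assoc]; exact hx _ (hx' _ hy)
      add_mem' := fun {x x'} hx hx' y hy => by
        rw [add_mul]; exact add_mem (hx _ hy) (hx' _ hy)
      algebraMap_mem' := fun c y hy => by
        rw [← Algebra.smul_def]; exact smul_mem _ _ hy }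
  refine ⟨A.toIntermediateField (Subalgebra.inv_mem_of_sq hsq A), le_antisymm ?_ ?_⟩
  · intro x hx
    have : x * 1 ∈ R := hx 1 h1
    rwa [mul_one] at this
  · rw [hR, span_le]
    rintro _ ⟨ε, rfl⟩
    refine A.prod_mem fun i _ => A.pow_mem (?_ : a i ∈ A) _
    exact fun y hy => mul_mem_span_prod hsq a i hy

/-- A complement of the line k·1 in `T` has dimension dim T - 1, and each of its basis vectors at
most doubles the degree, since its square lies in k. -/
theorem exists_intermediateField_ge
    (hsq : ∀ x : K, ∃ y : k, algebraMap k K y = x ^ 2) (T : Submodule k K)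
    [FiniteDimensional k T] (h1 : (1 : K) ∈ T) :
    ∃ Q : IntermediateField k K, (∀ t ∈ T, t ∈ Q) ∧ FiniteDimensional k Q ∧
      2 * finrank k Q ≤ 2 ^ finrank k T := by
  obtain ⟨C, hC⟩ := Submodule.exists_isCompl (span k {(1 : K)})
  have hle : span k {(1 : K)} ≤ T := by rwa [span_singleton_le_iff_mem]
  have hsup : span k {(1 : K)} ⊔ C ⊓ T = T := by
    rw [← sup_inf_assoc_of_le _ hle, hC.sup_eq_top, top_inf_eq]
  have hinf : span k {(1 : K)} ⊓ (C ⊓ T) = ⊥ := by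
    rw [← inf_assoc, hC.inf_eq_bot, bot_inf_eq]
  have : FiniteDimensional k ↥(C ⊓ T) := Submodule.finiteDimensional_inf_right _ _
  have hdim := finrank_sup_add_finrank_inf_eq (span k {(1 : K)}) (C ⊓ T)
  rw [hsup, hinf, finrank_bot, finrank_span_singleton one_ne_zero] at hdim
  let a : Fin (finrank k ↥(C ⊓ T)) → K := fun i => finBasis k ↥(C ⊓ T) i
  obtain ⟨Q, hQ⟩ := exists_intermediateField_eq_span hsq a
  have ha : ∀ i, a i ∈ Q := fun i => by
    have : a i ∈ Subalgebra.toSubmodule Q.toSubalgebra := by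
      rw [hQ]
      refine subset_span ⟨Pi.single i 1, ?_⟩
      dsimp only
      rw [Finset.prod_eq_single i] <;> simp +contextual
    exact this
  refine ⟨Q, fun t ht => ?_, ?_, ?_⟩
  · have : T ≤ Subalgebra.toSubmodule Q.toSubalgebra := by
      rw [← hsup, sup_le_iff, span_singleton_le_iff_mem]
      refine ⟨Q.one_mem, fun t ht => ?_⟩
      have h := congrArg (Subtype.val) ((finBasis k ↥(C ⊓ T)).sum_repr ⟨t, ht⟩)
      dsimp only at h
      rw [← h, AddSubmonoidClass.coe_finsetSum]
      exact sum_mem fun i _ => smul_mem _ _ (ha i)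
    exact this ht
  · have : FiniteDimensional k (Subalgebra.toSubmodule Q.toSubalgebra) := by
      rw [hQ]; exact FiniteDimensional.span_of_finite k (Set.finite_range _)
    exact this
  · have h : finrank k (Subalgebra.toSubmodule Q.toSubalgebra) ≤
        2 ^ finrank k ↥(C ⊓ T) := by
      rw [hQ]
      exact (finrank_range_le_card _).trans (by simp)
    have h' : finrank k Q = finrank k (Subalgebra.toSubmodule Q.toSubalgebra) := rfl
    rw [add_zero] at hdim
    rw [h', hdim, pow_add, pow_one]
    lia

instance finiteDimensional_span_intermediateField (M : IntermediateField k K)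
    (S : Submodule k K) [FiniteDimensional k S] :
    FiniteDimensional M (span M (S : Set K)) := by
  obtain ⟨s, hs⟩ := (Submodule.fg_iff_finiteDimensional S).2 ‹_›
  rw [← hs, span_span_of_tower]
  exact FiniteDimensional.span_finset M s

theorem finrank_span_le_finrank (M : IntermediateField k K) (S : Submodule k K)
    [FiniteDimensional k S] : finrank M (span M (S : Set K)) ≤ finrank k S := by
  have h : span k (Set.range fun i => (finBasis k S i : K)) = S := by
    have := congrArg (Submodule.map S.subtype) (finBasis k S).span_eq
    rwa [map_span, ← Set.range_comp, Submodule.map_top, range_subtype] at this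
  have h2 : span M (S : Set K) = span M (Set.range fun i => (finBasis k S i : K)) := by
    rw [← span_span_of_tower k M (Set.range fun i => (finBasis k S i : K)), h]
  rw [h2]
  exact (finrank_range_le_card _).trans (by simp)

/-- k(S) lies in M(S), which is generated over M by one element fewer than the M-dimension of the
span, because 1 ∈ S. -/
theorem two_mul_finrank_adjoin_le
    (hsq : ∀ x : K, ∃ y : k, algebraMap k K y = x ^ 2) (S : Submodule k K)
    [FiniteDimensional k S] (h1 : (1 : K) ∈ S) (M : IntermediateField k K)
    [FiniteDimensional k M] :
    2 * finrank k (IntermediateField.adjoin k (S : Set K)) ≤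
      finrank k M * 2 ^ finrank M (span M (S : Set K)) := by
  have hsqM : ∀ x : K, ∃ y : M, algebraMap M K y = x ^ 2 := fun x => by
    obtain ⟨y, hy⟩ := hsq x
    exact ⟨algebraMap k M y, by rw [← hy, ← IsScalarTower.algebraMap_apply]⟩
  obtain ⟨Q, hQ, hfin, hdim⟩ :=
    exists_intermediateField_ge hsqM (span M (S : Set K)) (subset_span h1)
  have hle : IntermediateField.adjoin k (S : Set K) ≤ Q.restrictScalars k :=
    IntermediateField.adjoin_le_iff.2 fun s hs => hQ s (subset_span hs)
  have hfin' : FiniteDimensional k Q := Module.Finite.trans (R := k) M Q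
  have h1 : finrank k (IntermediateField.adjoin k (S : Set K)) ≤ finrank k Q :=
    LinearMap.finrank_le_finrank_of_injective
      (f := (IntermediateField.inclusion hle).toLinearMap)
      (IntermediateField.inclusion_injective hle)
  have : Module.Free M Q := Module.Free.of_divisionRing M Q
  rw [← finrank_mul_finrank k M Q] at h1
  calc _ ≤ finrank k M * (2 * finrank M Q) := by lia
    _ ≤ _ := Nat.mul_le_mul_left _ hdim

/-- A complement of `T` in `S` adds at most dim S - dim T to the dimension of the M-span. -/
theorem finrank_span_add_finrank_le (M : IntermediateField k K) {T S : Submodule k K}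
    [FiniteDimensional k S] (hTS : T ≤ S) :
    finrank M (span M (S : Set K)) + finrank k T ≤
      finrank M (span M (T : Set K)) + finrank k S := by
  obtain ⟨C, hC⟩ := Submodule.exists_isCompl T
  have hsup : T ⊔ C ⊓ S = S := by
    rw [← sup_inf_assoc_of_le _ hTS, hC.sup_eq_top, top_inf_eq]
  have hinf : T ⊓ (C ⊓ S) = ⊥ := by
    rw [← inf_assoc, hC.inf_eq_bot, bot_inf_eq]
  have : FiniteDimensional k ↥(C ⊓ S) := Submodule.finiteDimensional_inf_right _ _
  have : FiniteDimensional k T := Submodule.finiteDimensional_of_le hTS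
  have hdim := finrank_sup_add_finrank_inf_eq T (C ⊓ S)
  rw [hsup, hinf, finrank_bot] at hdim
  have hle : span M (S : Set K) ≤ span M (T : Set K) ⊔ span M ((C ⊓ S : Submodule k K) : Set K) := by
    rw [span_le]
    intro s hs
    have hs' : s ∈ T ⊔ C ⊓ S := by rw [hsup]; exact hs
    obtain ⟨t, ht, c, hc, rfl⟩ := mem_sup.1 hs'
    exact add_mem (mem_sup_left (subset_span ht)) (mem_sup_right (subset_span hc))
  have h1 := Submodule.finrank_mono hle
  have h2 := Submodule.finrank_add_le_finrank_add_finrank (span M (T : Set K))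
    (span M ((C ⊓ S : Submodule k K) : Set K))
  have h3 := finrank_span_le_finrank M (C ⊓ S)
  lia

/-- A subspace contained in M spans at most the line M·1 over M, so it contributes at most 1. -/
theorem finrank_span_add_finrank_inf_le (M : IntermediateField k K) {T S : Submodule k K}
    [FiniteDimensional k S] (hTS : T ≤ S) (hTM : ∀ t ∈ T, t ∈ M) :
    finrank M (span M (S : Set K)) + finrank k T ≤ finrank k S + 1 := by
  have h := finrank_span_add_finrank_le M hTS
  have hle : span M (T : Set K) ≤ span M {(1 : K)} := by
    rw [span_le]
    exact fun t ht => mem_span_singleton.2 ⟨⟨t, hTM t ht⟩, by simp [Algebra.smul_def]⟩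
  have h1 := Submodule.finrank_mono hle
  rw [finrank_span_singleton one_ne_zero] at h1
  lia

end SquareRoots

/-! ### Spaces of values of minimal forms -/

section Minimal

variable {k K : Type*} [Field k] [Field K] [Algebra k K]

theorem IntermediateField.mem_adjoin_simple_iff_of_sq
    (hsq : ∀ x : K, ∃ y : k, algebraMap k K y = x ^ 2) (x α : K) :
    α ∈ IntermediateField.adjoin k {x} ↔
      ∃ a b : k, α = algebraMap k K a + algebraMap k K b * x := by
  constructor
  · intro h
    obtain ⟨y, hy⟩ := hsq x
    let A : Subalgebra k K :=
      { carrier := {α | ∃ a b : k, α = algebraMap k K a + algebraMap k K b * x}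
        mul_mem' := by
          rintro _ _ ⟨a, b, rfl⟩ ⟨c, d, rfl⟩
          refine ⟨a * c + b * d * y, a * d + b * c, ?_⟩
          simp only [map_add, map_mul, hy]; ring
        add_mem' := by
          rintro _ _ ⟨a, b, rfl⟩ ⟨c, d, rfl⟩
          refine ⟨a + c, b + d, ?_⟩
          simp only [map_add]; ring
        algebraMap_mem' := fun c => ⟨c, 0, by simp⟩ }
    have hx : x ∈ A := ⟨0, 1, by simp⟩
    have hle : IntermediateField.adjoin k {x} ≤
        A.toIntermediateField (Subalgebra.inv_mem_of_sq hsq A) := by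
      rw [IntermediateField.adjoin_simple_le_iff]; exact hx
    exact hle h
  · rintro ⟨a, b, rfl⟩
    exact add_mem (algebraMap_mem _ _)
      (mul_mem (algebraMap_mem _ _) (IntermediateField.mem_adjoin_simple_self k x))

theorem finrank_adjoin_finset_le (hsq : ∀ x : K, ∃ y : k, algebraMap k K y = x ^ 2)
    (s : Finset K) : FiniteDimensional k (IntermediateField.adjoin k (s : Set K)) ∧
      finrank k (IntermediateField.adjoin k (s : Set K)) ≤ 2 ^ s.card := by
  classical
  have hfin : FiniteDimensional k (span k ((insert 1 s : Finset K) : Set K)) :=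
    FiniteDimensional.span_finset _ _
  obtain ⟨Q, hQ, hQfin, hQdim⟩ := exists_intermediateField_ge hsq
    (span k ((insert 1 s : Finset K) : Set K)) (subset_span (by simp))
  have hle : IntermediateField.adjoin k (s : Set K) ≤ Q :=
    IntermediateField.adjoin_le_iff.2 fun x hx => hQ x (subset_span (by simp_all))
  have hinj := IntermediateField.inclusion_injective hle
  refine ⟨FiniteDimensional.of_injective (IntermediateField.inclusion hle).toLinearMap hinj, ?_⟩
  have h1 := LinearMap.finrank_le_finrank_of_injective
      (f := (IntermediateField.inclusion hle).toLinearMap) hinj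
  have h2 := (finrank_span_finset_le_card (R := k) (insert 1 s)).trans (Finset.card_insert_le 1 s)
  have h3 : 2 ^ finrank k (span k ((insert 1 s : Finset K) : Set K)) ≤ 2 ^ (s.card + 1) :=
    Nat.pow_le_pow_right (by norm_num) h2
  rw [pow_succ] at h3
  omega

theorem finrank_sup_span_singleton {T : Submodule k K} [FiniteDimensional k T] {x : K}
    (hx : x ∉ T) : finrank k ↥(T ⊔ span k {x}) = finrank k T + 1 := by
  have h0 : x ≠ 0 := fun h => hx (h ▸ T.zero_mem)
  have h := finrank_sup_add_finrank_inf_eq T (span k {x})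
  rw [((disjoint_span_singleton' h0).2 hx).eq_bot, finrank_bot, finrank_span_singleton h0] at h
  simpa using h

theorem finrank_restrictScalars_eq (M : IntermediateField k K) (U : Submodule M K) :
    finrank k ↥(U.restrictScalars k) = finrank k M * finrank M U := by
  have : Module.Free M U := Module.Free.of_divisionRing M U
  exact (finrank_mul_finrank k M U).symm

theorem mem_restrictScalars_span_singleton (M : IntermediateField k K) {p z : K} :
    z ∈ (span M {p}).restrictScalars k ↔ ∃ α ∈ M, α * p = z := by
  rw [restrictScalars_mem, mem_span_singleton]
  exact ⟨fun ⟨α, h⟩ => ⟨α, α.2, h⟩, fun ⟨α, hα, h⟩ => ⟨⟨α, hα⟩, h⟩⟩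

theorem finrank_restrictScalars_span_singleton (M : IntermediateField k K) {p : K}
    (hp : p ≠ 0) : finrank k ↥((span M {p}).restrictScalars k) = finrank k M := by
  rw [finrank_restrictScalars_eq, finrank_span_singleton hp, mul_one]

theorem finiteDimensional_restrictScalars_span_singleton (M : IntermediateField k K)
    [FiniteDimensional k M] (p : K) :
    FiniteDimensional k ↥((span M {p}).restrictScalars k) := by
  have : FiniteDimensional k (span M {p}) := Module.Finite.trans (R := k) M (span M {p})
  exact this

theorem finrank_span_le_card_of_subset (M : IntermediateField k K) (T : Submodule k K)
    (s : Finset K) (h : ∀ t ∈ T, t ∈ span M (s : Set K)) :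
    finrank M (span M (T : Set K)) ≤ s.card := by
  have : FiniteDimensional M (span M (s : Set K)) := FiniteDimensional.span_finset _ _
  exact (Submodule.finrank_mono (span_le.2 h)).trans (finrank_span_finset_le_card s)

theorem finrank_map_mulLeft (S : Submodule k K) {p : K} (hp : p ≠ 0) :
    finrank k ↥(S.map (LinearMap.mulLeft k p)) = finrank k S :=
  (LinearEquiv.finrank_eq
    (Submodule.equivMapOfInjective _ (fun _ _ h => mul_left_cancel₀ hp h) S)).symm

theorem map_mulLeft_eq_of_le {S S' : Submodule k K} [FiniteDimensional k S'] {p : K}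
    (hp : p ≠ 0) (hdim : finrank k S = finrank k S') (h : ∀ s ∈ S, p * s ∈ S') :
    S.map (LinearMap.mulLeft k p) = S' := by
  refine Submodule.eq_of_le_of_finrank_eq ?_ ((finrank_map_mulLeft S hp).trans hdim)
  rintro _ ⟨s, hs, rfl⟩
  exact h s hs

section Pair

-- What minimality of `S` and equality of span dimensions provide. `hlow`: over M of degree at most
-- 2^j, a subspace of `S'` loses at most j dimensions. `hcap`: such an M meets `S` in dimension at
-- most j + 1. `hup`: whatever part of `S` lies in M, the space `S'` shrinks over M accordingly.
variable (hsq : ∀ x : K, ∃ y : k, algebraMap k K y = x ^ 2)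
  {N : IntermediateField k K} {S S' : Submodule k K} [FiniteDimensional k S']
  (hlow : ∀ M : IntermediateField k K, M ≤ N → FiniteDimensional k M → ∀ j,
    finrank k M ≤ 2 ^ j → ∀ T ≤ S', finrank k T ≤ j + finrank M (span M (T : Set K)))
  (hcap : ∀ M : IntermediateField k K, M ≤ N → FiniteDimensional k M → ∀ j,
    finrank k M ≤ 2 ^ j → ∀ T ≤ S, (∀ t ∈ T, t ∈ M) → finrank k T ≤ j + 1)
  (hup : ∀ M : IntermediateField k K, M ≤ N → FiniteDimensional k M → ∀ T ≤ S,
    (∀ t ∈ T, t ∈ M) → finrank M (span M (S' : Set K)) + finrank k T ≤ finrank k S' + 1)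
  (hSN : ∀ s ∈ S, s ∈ N) (h1 : (1 : K) ∈ S)

include hsq

theorem finrank_adjoin_simple_eq {x : K} (hx : x ∉ span k {(1 : K)}) :
    FiniteDimensional k (IntermediateField.adjoin k {x}) ∧
      finrank k (IntermediateField.adjoin k {x}) = 2 := by
  have h := finrank_adjoin_finset_le hsq {x}
  rw [Finset.coe_singleton, Finset.card_singleton] at h
  obtain ⟨hfin, hle⟩ := h
  refine ⟨hfin, le_antisymm (by simpa using hle) ?_⟩
  have h2 := finrank_sup_span_singleton hx
  rw [finrank_span_singleton one_ne_zero] at h2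
  have h3 : span k {(1 : K)} ⊔ span k {x} ≤
      Subalgebra.toSubmodule (IntermediateField.adjoin k {x}).toSubalgebra := by
    rw [sup_le_iff, span_singleton_le_iff_mem, span_singleton_le_iff_mem]
    exact ⟨one_mem (IntermediateField.adjoin k {x}),
      IntermediateField.mem_adjoin_simple_self k x⟩
  have : FiniteDimensional k
      (Subalgebra.toSubmodule (IntermediateField.adjoin k {x}).toSubalgebra) := hfin
  have h4 := Submodule.finrank_mono h3
  rw [h2] at h4
  exact h4

omit [FiniteDimensional k S'] in
theorem restrictScalars_span_singleton_le {x p : K} (hp : p ∈ S') (hxp : x * p ∈ S') :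
    (span (IntermediateField.adjoin k {x}) {p}).restrictScalars k ≤ S' := by
  intro z hz
  obtain ⟨α, hα, rfl⟩ := (mem_restrictScalars_span_singleton _).1 hz
  obtain ⟨a, b, rfl⟩ := (IntermediateField.mem_adjoin_simple_iff_of_sq hsq x α).1 hα
  rw [add_mul, mul_assoc, ← Algebra.smul_def, ← Algebra.smul_def]
  exact add_mem (smul_mem _ _ hp) (smul_mem _ _ hxp)

include hup hSN h1 in
-- With X = k(x) and n = dim S', `hup` gives dim_X(XS') ≤ n - 1, so XS' has k-dimension at most 2n -
-- 2. It contains the n-dimensional spaces S' and xS', which must therefore meet.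
theorem exists_mem_mul_mem {x : K} (hxS : x ∈ S) (hx : x ∉ span k {(1 : K)}) :
    ∃ p ∈ S', p ≠ 0 ∧ x * p ∈ S' := by
  obtain ⟨hfin, hdim⟩ := finrank_adjoin_simple_eq hsq hx
  have hxN : IntermediateField.adjoin k {x} ≤ N :=
    (IntermediateField.adjoin_simple_le_iff).2 (hSN x hxS)
  have h := hup _ hxN hfin (span k {(1 : K)} ⊔ span k {x})
    (by rw [sup_le_iff, span_singleton_le_iff_mem, span_singleton_le_iff_mem]
        exact ⟨h1, hxS⟩)
    (fun t ht => by
      have h3 : span k {(1 : K)} ⊔ span k {x} ≤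
          Subalgebra.toSubmodule (IntermediateField.adjoin k {x}).toSubalgebra := by
        rw [sup_le_iff, span_singleton_le_iff_mem, span_singleton_le_iff_mem]
        exact ⟨one_mem (IntermediateField.adjoin k {x}),
          IntermediateField.mem_adjoin_simple_self k x⟩
      exact h3 ht)
  rw [finrank_sup_span_singleton hx, finrank_span_singleton one_ne_zero] at h
  have hx0 : x ≠ 0 := fun h => hx (h ▸ zero_mem _)
  have hle : S' ⊔ S'.map (LinearMap.mulLeft k x) ≤
      (span (IntermediateField.adjoin k {x}) (S' : Set K)).restrictScalars k := by
    rw [sup_le_iff]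
    refine ⟨fun s hs => subset_span hs, ?_⟩
    rintro _ ⟨s, hs, rfl⟩
    exact smul_mem (span (IntermediateField.adjoin k {x}) (S' : Set K))
      (⟨x, IntermediateField.mem_adjoin_simple_self k x⟩ : IntermediateField.adjoin k {x})
      (subset_span hs)
  have : FiniteDimensional k
      ↥((span (IntermediateField.adjoin k {x}) (S' : Set K)).restrictScalars k) :=
    Module.Finite.trans (R := k) (IntermediateField.adjoin k {x})
      (span (IntermediateField.adjoin k {x}) (S' : Set K))
  have h2 := Submodule.finrank_mono hle
  rw [finrank_restrictScalars_eq, hdim] at h2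
  have h3 := finrank_sup_add_finrank_inf_eq S' (S'.map (LinearMap.mulLeft k x))
  rw [finrank_map_mulLeft S' hx0] at h3
  have h4 : S' ⊓ S'.map (LinearMap.mulLeft k x) ≠ ⊥ := by
    intro h0
    rw [h0, finrank_bot] at h3
    omega
  obtain ⟨z, ⟨hz, p, hp, rfl⟩, hz0⟩ := (Submodule.ne_bot_iff _).1 h4
  exact ⟨p, hp, fun h => hz0 (by simp [h]), hz⟩

omit [FiniteDimensional k S'] in
include hlow hSN in
-- Uniqueness of the multiplier up to X = k(x): if Xp ≠ Xw, then Xp ⊕ Xw is a 4-dimensional subspace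
-- of `S'` with X-span of dimension at most 2, while `hlow` demands 4 ≤ 1 + 2.
theorem exists_mem_adjoin_mul_eq {x : K} (hxS : x ∈ S) (hx : x ∉ span k {(1 : K)})
    {p w : K} (hp0 : p ≠ 0) (hp : p ∈ S') (hxp : x * p ∈ S') (hw : w ∈ S') (hxw : x * w ∈ S') :
    ∃ α ∈ IntermediateField.adjoin k {x}, α * p = w := by
  classical
  by_contra! hne
  have hw0 : w ≠ 0 := fun h => hne 0 (zero_mem _) (by simp [h])
  obtain ⟨hfin, hdim⟩ := finrank_adjoin_simple_eq hsq hx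
  set X := IntermediateField.adjoin k {x}
  have hxN : X ≤ N := (IntermediateField.adjoin_simple_le_iff).2 (hSN x hxS)
  have := finiteDimensional_restrictScalars_span_singleton X p
  have := finiteDimensional_restrictScalars_span_singleton X w
  have hd := finrank_sup_add_finrank_inf_eq ((span X {p}).restrictScalars k)
    ((span X {w}).restrictScalars k)
  have hbot : (span X {p}).restrictScalars k ⊓ (span X {w}).restrictScalars k = ⊥ := by
    rw [Submodule.eq_bot_iff]
    rintro z ⟨hz1, hz2⟩
    obtain ⟨α, hα, rfl⟩ := (mem_restrictScalars_span_singleton _).1 hz1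
    obtain ⟨β, hβ, h⟩ := (mem_restrictScalars_span_singleton _).1 hz2
    by_cases hβ0 : β = 0
    · rw [← h, hβ0, zero_mul]
    · refine absurd ?_ (hne (β⁻¹ * α) (mul_mem (inv_mem hβ) hα))
      rw [mul_assoc, ← h]; field_simp
  rw [hbot, finrank_bot, finrank_restrictScalars_span_singleton X hp0,
    finrank_restrictScalars_span_singleton X hw0, hdim] at hd
  have h2 := hlow X hxN hfin 1 (by rw [hdim]; norm_num)
    ((span X {p}).restrictScalars k ⊔ (span X {w}).restrictScalars k)
    (sup_le (restrictScalars_span_singleton_le hsq hp hxp)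
      (restrictScalars_span_singleton_le hsq hw hxw))
  have h3 := finrank_span_le_card_of_subset X
    ((span X {p}).restrictScalars k ⊔ (span X {w}).restrictScalars k) {p, w} (by
      intro t ht
      obtain ⟨a, ha, b, hb, rfl⟩ := mem_sup.1 ht
      refine add_mem (span_mono ?_ ha) (span_mono ?_ hb) <;> simp)
  have h4 : ({p, w} : Finset K).card ≤ 2 := Finset.card_le_two
  omega

include hlow hcap hup hSN h1 in
-- Let p, q, r be multipliers for x, y and x + y. If x and y had no common multiplier, then k(x)p
-- and k(y)q would be independent, and dimension counts over k(x, y) would place a nonzero multiple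
-- of r in an impossible position inside their sum.
theorem exists_common_mem {x y : K} (hxS : x ∈ S) (hyS : y ∈ S) (hx : x ∉ span k {(1 : K)})
    (hy : y ∉ span k {(1 : K)} ⊔ span k {x}) :
    ∃ w ∈ S', w ≠ 0 ∧ x * w ∈ S' ∧ y * w ∈ S' := by
  classical
  by_contra! hne
  have hy1 : y ∉ span k {(1 : K)} := fun h => hy (mem_sup_left h)
  have hz1 : x + y ∉ span k {(1 : K)} := fun h => hy (by
    rw [show y = (x + y) - x by ring]
    exact sub_mem (mem_sup_left h) (mem_sup_right (mem_span_singleton_self x)))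
  have hzS : x + y ∈ S := add_mem hxS hyS
  obtain ⟨p, hp, hp0, hxp⟩ := exists_mem_mul_mem hsq hup hSN h1 hxS hx
  obtain ⟨q, hq, hq0, hyq⟩ := exists_mem_mul_mem hsq hup hSN h1 hyS hy1
  obtain ⟨r, hr, hr0, hzr⟩ := exists_mem_mul_mem hsq hup hSN h1 hzS hz1
  obtain ⟨hXfin, hXdim⟩ := finrank_adjoin_simple_eq hsq hx
  obtain ⟨hYfin, hYdim⟩ := finrank_adjoin_simple_eq hsq hy1
  obtain ⟨hZfin, hZdim⟩ := finrank_adjoin_simple_eq hsq hz1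
  obtain ⟨hMfin, hMdim⟩ := finrank_adjoin_finset_le hsq {x, y}
  have hMdim : finrank k (IntermediateField.adjoin k (({x, y} : Finset K) : Set K)) ≤ 2 ^ 2 :=
    hMdim.trans (Nat.pow_le_pow_right (by norm_num) Finset.card_le_two)
  set X := IntermediateField.adjoin k {x}
  set Y := IntermediateField.adjoin k {y}
  set Z := IntermediateField.adjoin k {x + y}
  set M := IntermediateField.adjoin k (({x, y} : Finset K) : Set K)
  have hxM : x ∈ M := IntermediateField.subset_adjoin _ _ (by simp)
  have hyM : y ∈ M := IntermediateField.subset_adjoin _ _ (by simp)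
  have hXM : X ≤ M := IntermediateField.adjoin_simple_le_iff.2 hxM
  have hYM : Y ≤ M := IntermediateField.adjoin_simple_le_iff.2 hyM
  have hZM : Z ≤ M := IntermediateField.adjoin_simple_le_iff.2 (add_mem hxM hyM)
  have hMN : M ≤ N := IntermediateField.adjoin_le_iff.2 fun t ht => by
    rcases (by simpa using ht : t = x ∨ t = y) with rfl | rfl
    exacts [hSN _ hxS, hSN _ hyS]
  have h3dim := finrank_sup_span_singleton hy
  rw [finrank_sup_span_singleton hx, finrank_span_singleton one_ne_zero] at h3dim
  have hnotboth : ∀ L : IntermediateField k K, L ≤ M → FiniteDimensional k L →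
      finrank k L = 2 → x ∈ L → y ∈ L → False := fun L hL hLfin hLdim hxL hyL => by
    have h := hcap L (hL.trans hMN) hLfin 1 (by rw [hLdim]; norm_num)
      (span k {(1 : K)} ⊔ span k {x} ⊔ span k {y})
      (by simp only [sup_le_iff, span_singleton_le_iff_mem]; exact ⟨⟨h1, hxS⟩, hyS⟩)
      (fun t ht => by
        have h3 : span k {(1 : K)} ⊔ span k {x} ⊔ span k {y} ≤
            Subalgebra.toSubmodule L.toSubalgebra := by
          simp only [sup_le_iff, span_singleton_le_iff_mem]
          exact ⟨⟨one_mem L, hxL⟩, hyL⟩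
        exact h3 ht)
    omega
  have := finiteDimensional_restrictScalars_span_singleton X p
  have := finiteDimensional_restrictScalars_span_singleton Y q
  have hP1 := restrictScalars_span_singleton_le (S' := S') hsq hp hxp
  have hP2 := restrictScalars_span_singleton_le (S' := S') hsq hq hyq
  have hP3 := restrictScalars_span_singleton_le (S' := S') hsq hr hzr
  have hd := finrank_sup_add_finrank_inf_eq ((span X {p}).restrictScalars k)
    ((span Y {q}).restrictScalars k)
  -- A nonzero element of the intersection would be a common multiplier of x and y.
  have hbot : (span X {p}).restrictScalars k ⊓ (span Y {q}).restrictScalars k = ⊥ := by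
    rw [Submodule.eq_bot_iff]
    rintro z ⟨hz1, hz2⟩
    by_contra hz0
    refine hne z (hP1 hz1) hz0 ?_ ?_
    · exact hP1 (smul_mem (span X {p})
        (⟨x, IntermediateField.mem_adjoin_simple_self k x⟩ : X) hz1)
    · exact hP2 (smul_mem (span Y {q})
        (⟨y, IntermediateField.mem_adjoin_simple_self k y⟩ : Y) hz2)
  rw [hbot, finrank_bot, finrank_restrictScalars_span_singleton X hp0,
    finrank_restrictScalars_span_singleton Y hq0, hXdim, hYdim, add_zero] at hd
  set P₁ := (span X {p}).restrictScalars k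
  set P₂ := (span Y {q}).restrictScalars k
  have hmono : ∀ {L : IntermediateField k K}, L ≤ M → ∀ {s : K} {U : Set K}, s ∈ U →
      ∀ t ∈ (span L {s}).restrictScalars k, t ∈ span M U := fun {L} hL {s U} hs t ht => by
    obtain ⟨α, hα, rfl⟩ := (mem_restrictScalars_span_singleton _).1 ht
    exact smul_mem (span M U) (⟨α, hL hα⟩ : M) (subset_span hs)
  -- Otherwise the three planes span dimension 6 in `S'`, against the bound 2 + 3.
  obtain ⟨r', hr'3, hr'12, hr'0⟩ : ∃ r' ∈ (span Z {r}).restrictScalars k,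
      r' ∈ P₁ ⊔ P₂ ∧ r' ≠ 0 := by
    by_contra! hcon
    have := finiteDimensional_restrictScalars_span_singleton Z r
    have hd3 := finrank_sup_add_finrank_inf_eq (P₁ ⊔ P₂) ((span Z {r}).restrictScalars k)
    have hbot3 : (P₁ ⊔ P₂) ⊓ (span Z {r}).restrictScalars k = ⊥ := by
      rw [Submodule.eq_bot_iff]
      rintro z ⟨h12, h3⟩
      exact hcon z h3 h12
    rw [hbot3, finrank_bot, finrank_restrictScalars_span_singleton Z hr0, hd, hZdim] at hd3
    have h5 := hlow M hMN hMfin 2 hMdim (P₁ ⊔ P₂ ⊔ (span Z {r}).restrictScalars k)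
      (sup_le (sup_le hP1 hP2) hP3)
    have h6 := finrank_span_le_card_of_subset M
      (P₁ ⊔ P₂ ⊔ (span Z {r}).restrictScalars k) {p, q, r} (by
        intro t ht
        obtain ⟨ab, hab, c, hc, rfl⟩ := mem_sup.1 ht
        obtain ⟨a, ha, b, hb, rfl⟩ := mem_sup.1 hab
        exact add_mem (add_mem (hmono hXM (by simp) _ ha) (hmono hYM (by simp) _ hb))
          (hmono hZM (by simp) _ hc))
    have h7 : ({p, q, r} : Finset K).card ≤ 3 := Finset.card_le_three
    omega
  have hr'S : r' ∈ S' := hP3 hr'3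
  have hzr'S : (x + y) * r' ∈ S' := hP3 (smul_mem (span Z {r})
    (⟨x + y, IntermediateField.mem_adjoin_simple_self k (x + y)⟩ : Z) hr'3)
  have h12span : ∀ t ∈ P₁ ⊔ P₂, t ∈ span M (({p, q} : Finset K) : Set K) := fun t ht => by
    obtain ⟨a, ha, b, hb, rfl⟩ := mem_sup.1 ht
    exact add_mem (hmono hXM (by simp) _ ha) (hmono hYM (by simp) _ hb)
  -- Otherwise `S'` contains a 5-dimensional space with M-span of dimension at most 2, against the
  -- bound 2 + 2.
  have hzr'12 : (x + y) * r' ∈ P₁ ⊔ P₂ := by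
    by_contra hcon
    have h4 := finrank_sup_span_singleton hcon
    rw [hd] at h4
    have h5 := hlow M hMN hMfin 2 hMdim (P₁ ⊔ P₂ ⊔ span k {(x + y) * r'})
      (sup_le (sup_le hP1 hP2) (by rwa [span_singleton_le_iff_mem]))
    have h6 := finrank_span_le_card_of_subset M (P₁ ⊔ P₂ ⊔ span k {(x + y) * r'}) {p, q} (by
      intro t ht
      obtain ⟨ab, hab, c, hc, rfl⟩ := mem_sup.1 ht
      refine add_mem (h12span _ hab) ?_
      obtain ⟨e, rfl⟩ := mem_span_singleton.1 hc
      rw [← algebraMap_smul M e]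
      exact smul_mem _ _ (smul_mem _ (⟨x + y, add_mem hxM hyM⟩ : M) (h12span _ hr'12)))
    have h7 : ({p, q} : Finset K).card ≤ 2 := Finset.card_le_two
    omega
  -- p and q are independent over M: otherwise the 4-dimensional sum has M-span of dimension 1,
  -- against the bound 2 + 1.
  have hqp : ∀ γ ∈ M, γ * p ≠ q := by
    rintro γ hγ rfl
    have h5 := hlow M hMN hMfin 2 hMdim (P₁ ⊔ P₂) (sup_le hP1 hP2)
    have h6 := finrank_span_le_card_of_subset M (P₁ ⊔ P₂) {p} (by
      intro t ht
      obtain ⟨a, ha, b, hb, rfl⟩ := mem_sup.1 ht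
      refine add_mem (hmono hXM (by simp) _ ha) ?_
      obtain ⟨β, hβ, rfl⟩ := (mem_restrictScalars_span_singleton _).1 hb
      rw [← mul_assoc]
      exact smul_mem (span M (({p} : Finset K) : Set K)) (⟨β * γ, mul_mem (hYM hβ) hγ⟩ : M)
        (subset_span (by simp)))
    rw [Finset.card_singleton] at h6
    omega
  obtain ⟨a, ha, b, hb, hab⟩ := mem_sup.1 hr'12
  obtain ⟨α, hα, rfl⟩ := (mem_restrictScalars_span_singleton _).1 ha
  obtain ⟨β, hβ, rfl⟩ := (mem_restrictScalars_span_singleton _).1 hb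
  obtain ⟨a', ha', b', hb', hab'⟩ := mem_sup.1 hzr'12
  obtain ⟨α', hα', rfl⟩ := (mem_restrictScalars_span_singleton _).1 ha'
  obtain ⟨β', hβ', rfl⟩ := (mem_restrictScalars_span_singleton _).1 hb'
  have hrel : ((x + y) * α - α') * p + ((x + y) * β - β') * q = 0 := by
    rw [← hab] at hab'; linear_combination -hab'
  have hzM : x + y ∈ M := add_mem hxM hyM
  have hβeq : (x + y) * β - β' = 0 := by
    by_contra h0
    refine hqp (-(((x + y) * β - β')⁻¹ * ((x + y) * α - α'))) ?_ ?_
    · exact neg_mem (mul_mem (inv_mem (sub_mem (mul_mem hzM (hYM hβ)) (hYM hβ')))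
        (sub_mem (mul_mem hzM (hXM hα)) (hXM hα')))
    · field_simp
      linear_combination -hrel
  have hαeq : (x + y) * α - α' = 0 := by
    rw [hβeq, zero_mul, add_zero] at hrel
    exact (mul_eq_zero.1 hrel).resolve_right hp0
  -- If α ≠ 0, then x + y ∈ X, so the quadratic field X contains the three independent elements 1,
  -- x, y of `S`. The case of β is symmetric.
  have hα0 : α = 0 := by
    by_contra h0
    have h : x + y = α' * α⁻¹ := by
      rw [eq_mul_inv_iff_mul_eq₀ h0]; exact sub_eq_zero.1 hαeq
    have hxX := IntermediateField.mem_adjoin_simple_self k x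
    refine hnotboth X hXM hXfin hXdim hxX ?_
    rw [show y = (x + y) - x by ring, h]
    exact sub_mem (mul_mem hα' (inv_mem hα)) hxX
  have hβ0 : β = 0 := by
    by_contra h0
    have h : x + y = β' * β⁻¹ := by
      rw [eq_mul_inv_iff_mul_eq₀ h0]; exact sub_eq_zero.1 hβeq
    have hyY := IntermediateField.mem_adjoin_simple_self k y
    refine hnotboth Y hYM hYfin hYdim ?_ hyY
    rw [show x = (x + y) - y by ring, h]
    exact sub_mem (mul_mem hβ' (inv_mem hβ)) hyY
  exact hr'0 (by rw [← hab, hα0, hβ0]; simp)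

include hlow hcap hup hSN h1 in
-- Let u = αp be a common multiplier of x and z, and v = βp one of y and z, with α ∈ k(x) and β ∈
-- k(y). Uniqueness for z gives ζα = β with ζ ∈ k(z). As 1, x, y, z are independent, `hcap` forces ζ
-- ∈ k, then α ∈ k, so p is proportional to u and works for z.
theorem mul_common_mem {x y z p : K} (hxS : x ∈ S) (hyS : y ∈ S) (hzS : z ∈ S)
    (hx : x ∉ span k {(1 : K)}) (hy : y ∉ span k {(1 : K)} ⊔ span k {x})
    (hz : z ∉ span k {(1 : K)} ⊔ span k {x} ⊔ span k {y})
    (hp0 : p ≠ 0) (hp : p ∈ S') (hxp : x * p ∈ S') (hyp : y * p ∈ S') : z * p ∈ S' := by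
  classical
  have hy1 : y ∉ span k {(1 : K)} := fun h => hy (mem_sup_left h)
  have hz1 : z ∉ span k {(1 : K)} := fun h => hz (mem_sup_left (mem_sup_left h))
  have hzx : z ∉ span k {(1 : K)} ⊔ span k {x} := fun h => hz (mem_sup_left h)
  have hzy : z ∉ span k {(1 : K)} ⊔ span k {y} := fun h => hz
    ((sup_le_sup_right le_sup_left (span k {y}) : _ ≤ span k {(1 : K)} ⊔ span k {x} ⊔ span k {y}) h)
  obtain ⟨u, hu, hu0, hxu, hzu⟩ := exists_common_mem hsq hlow hcap hup hSN h1 hxS hzS hx hzx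
  obtain ⟨v, hv, hv0, hyv, hzv⟩ := exists_common_mem hsq hlow hcap hup hSN h1 hyS hzS hy1 hzy
  obtain ⟨α, hα, rfl⟩ := exists_mem_adjoin_mul_eq hsq hlow hSN hxS hx hp0 hp hxp hu hxu
  obtain ⟨β, hβ, rfl⟩ := exists_mem_adjoin_mul_eq hsq hlow hSN hyS hy1 hp0 hp hyp hv hyv
  obtain ⟨ζ, hζ, h⟩ := exists_mem_adjoin_mul_eq hsq hlow hSN hzS hz1 hu0 hu hzu hv hzv
  have hα0 : α ≠ 0 := left_ne_zero_of_mul hu0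
  have hβ0 : β ≠ 0 := left_ne_zero_of_mul hv0
  have hζα : ζ * α = β := mul_right_cancel₀ hp0 (by rw [← h]; ring)
  obtain ⟨hMfin, hMdim⟩ := finrank_adjoin_finset_le hsq {x, y}
  have hMdim : finrank k (IntermediateField.adjoin k (({x, y} : Finset K) : Set K)) ≤ 2 ^ 2 :=
    hMdim.trans (Nat.pow_le_pow_right (by norm_num) Finset.card_le_two)
  set M := IntermediateField.adjoin k (({x, y} : Finset K) : Set K)
  have hxM : x ∈ M := IntermediateField.subset_adjoin _ _ (by simp)
  have hyM : y ∈ M := IntermediateField.subset_adjoin _ _ (by simp)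
  have hXM : IntermediateField.adjoin k {x} ≤ M := IntermediateField.adjoin_simple_le_iff.2 hxM
  have hYM : IntermediateField.adjoin k {y} ≤ M := IntermediateField.adjoin_simple_le_iff.2 hyM
  have hMN : M ≤ N := IntermediateField.adjoin_le_iff.2 fun t ht => by
    rcases (by simpa using ht : t = x ∨ t = y) with rfl | rfl
    exacts [hSN _ hxS, hSN _ hyS]
  have h3dim := finrank_sup_span_singleton hy
  rw [finrank_sup_span_singleton hx, finrank_span_singleton one_ne_zero] at h3dim
  have h4dim := finrank_sup_span_singleton hz
  rw [h3dim] at h4dim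
  have hzM : z ∉ M := fun hzM => by
    have h := hcap M hMN hMfin 2 hMdim
      (span k {(1 : K)} ⊔ span k {x} ⊔ span k {y} ⊔ span k {z})
      (by simp only [sup_le_iff, span_singleton_le_iff_mem]; exact ⟨⟨⟨h1, hxS⟩, hyS⟩, hzS⟩)
      (fun t ht => by
        have h3 : span k {(1 : K)} ⊔ span k {x} ⊔ span k {y} ⊔ span k {z} ≤
            Subalgebra.toSubmodule M.toSubalgebra := by
          simp only [sup_le_iff, span_singleton_le_iff_mem]
          exact ⟨⟨⟨one_mem M, hxM⟩, hyM⟩, hzM⟩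
        exact h3 ht)
    omega
  have hxY : x ∉ IntermediateField.adjoin k {y} := fun hxY => by
    obtain ⟨hYfin, hYdim⟩ := finrank_adjoin_simple_eq hsq hy1
    have h := hcap _ (hYM.trans hMN) hYfin 1 (by rw [hYdim]; norm_num)
      (span k {(1 : K)} ⊔ span k {x} ⊔ span k {y})
      (by simp only [sup_le_iff, span_singleton_le_iff_mem]; exact ⟨⟨h1, hxS⟩, hyS⟩)
      (fun t ht => by
        have h3 : span k {(1 : K)} ⊔ span k {x} ⊔ span k {y} ≤
            Subalgebra.toSubmodule (IntermediateField.adjoin k {y}).toSubalgebra := by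
          simp only [sup_le_iff, span_singleton_le_iff_mem]
          exact ⟨⟨one_mem (IntermediateField.adjoin k {y}), hxY⟩,
            IntermediateField.mem_adjoin_simple_self k y⟩
        exact h3 ht)
    omega
  obtain ⟨a, b, rfl⟩ := (IntermediateField.mem_adjoin_simple_iff_of_sq hsq z ζ).1 hζ
  by_cases hb : b = 0
  · subst hb
    rw [map_zero, zero_mul, add_zero] at hζα
    obtain ⟨c, e, rfl⟩ := (IntermediateField.mem_adjoin_simple_iff_of_sq hsq x α).1 hα
    have ha0 : algebraMap k K a ≠ 0 := fun h0 => hβ0 (by rw [← hζα, h0, zero_mul])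
    by_cases he : e = 0
    · subst he
      rw [map_zero, zero_mul, add_zero] at hα0 hzu
      have hc0 : c ≠ 0 := fun h0 => hα0 (by rw [h0, map_zero])
      have : z * p = c⁻¹ • (z * (algebraMap k K c * p)) := by
        rw [Algebra.smul_def, map_inv₀]; field_simp
      rw [this]
      exact smul_mem _ _ hzu
    · refine absurd ?_ hxY
      have he0 : algebraMap k K e ≠ 0 := by simpa using he
      have : x = (algebraMap k K e)⁻¹ * ((algebraMap k K a)⁻¹ * β - algebraMap k K c) := by
        rw [← hζα]; field_simp; ring
      rw [this]
      exact mul_mem (inv_mem (algebraMap_mem _ _)) (sub_mem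
        (mul_mem (inv_mem (algebraMap_mem _ _)) hβ) (algebraMap_mem _ _))
  · refine absurd ?_ hzM
    have hb0 : algebraMap k K b ≠ 0 := by simpa using hb
    have : z = (algebraMap k K b)⁻¹ * (β * α⁻¹ - algebraMap k K a) := by
      rw [← hζα]; field_simp; ring
    rw [this]
    exact mul_mem (inv_mem (algebraMap_mem _ _)) (sub_mem
      (mul_mem (hYM hβ) (inv_mem (hXM hα))) (algebraMap_mem _ _))

end Pair

/-- A common multiplier of two elements independent modulo k·1 works for every third one, hence for
all of `S`; dimensions 1 and 2 need only one element. The bound on degrees of generated fields turns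
minimality into the three dimension estimates used for this. -/
theorem exists_map_mulLeft_eq_of_minimal
    (hsq : ∀ x : K, ∃ y : k, algebraMap k K y = x ^ 2)
    (S S' : Submodule k K) [FiniteDimensional k S] [FiniteDimensional k S']
    (h1 : (1 : K) ∈ S) (hdim : finrank k S = finrank k S')
    (hmin : 2 ^ finrank k S ≤ 2 * finrank k (IntermediateField.adjoin k (S : Set K)))
    (hV : ∀ M : IntermediateField k K, M ≤ IntermediateField.adjoin k (S : Set K) →
      finrank M (span M (S : Set K)) = finrank M (span M (S' : Set K))) :
    ∃ p ≠ 0, S.map (LinearMap.mulLeft k p) = S' := by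
  set N := IntermediateField.adjoin k (S : Set K)
  have hlow' : ∀ M : IntermediateField k K, M ≤ N → FiniteDimensional k M → ∀ j,
      finrank k M ≤ 2 ^ j → finrank k S ≤ j + finrank M (span M (S : Set K)) := by
    intro M hM hfin j hj
    have h := hmin.trans (two_mul_finrank_adjoin_le hsq S h1 M)
    have h2 : 2 ^ finrank k S ≤ 2 ^ (j + finrank M (span M (S : Set K))) := by
      rw [pow_add]; exact h.trans (Nat.mul_le_mul_right _ hj)
    exact (Nat.pow_le_pow_iff_right (by norm_num)).1 h2
  have hlow : ∀ M : IntermediateField k K, M ≤ N → FiniteDimensional k M → ∀ j,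
      finrank k M ≤ 2 ^ j → ∀ T ≤ S', finrank k T ≤ j + finrank M (span M (T : Set K)) := by
    intro M hM hfin j hj T hT
    have h2 := hlow' M hM hfin j hj
    have h3 := finrank_span_add_finrank_le M hT
    have h4 := hV M hM
    omega
  have hcap : ∀ M : IntermediateField k K, M ≤ N → FiniteDimensional k M → ∀ j,
      finrank k M ≤ 2 ^ j → ∀ T ≤ S, (∀ t ∈ T, t ∈ M) → finrank k T ≤ j + 1 := by
    intro M hM hfin j hj T hT hTM
    have h2 := hlow' M hM hfin j hj
    have h3 := finrank_span_add_finrank_inf_le M hT hTM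
    omega
  have hup : ∀ M : IntermediateField k K, M ≤ N → FiniteDimensional k M → ∀ T ≤ S,
      (∀ t ∈ T, t ∈ M) →
      finrank M (span M (S' : Set K)) + finrank k T ≤ finrank k S' + 1 := by
    intro M hM hfin T hT hTM
    have h3 := finrank_span_add_finrank_inf_le M hT hTM
    have h4 := hV M hM
    omega
  have hSN : ∀ s ∈ S, s ∈ N := fun s hs => IntermediateField.subset_adjoin _ _ hs
  suffices h : ∃ p ≠ 0, ∀ s ∈ S, p * s ∈ S' by
    obtain ⟨p, hp0, hp⟩ := h
    exact ⟨p, hp0, map_mulLeft_eq_of_le hp0 hdim hp⟩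
  have hle : ∀ {p : K} {T : Submodule k K}, T ≤ S'.comap (LinearMap.mulLeft k p) →
      ∀ s ∈ T, p * s ∈ S' := fun h s hs => h hs
  by_cases hx : ∃ x ∈ S, x ∉ span k {(1 : K)}
  · obtain ⟨x, hxS, hx⟩ := hx
    by_cases hy : ∃ y ∈ S, y ∉ span k {(1 : K)} ⊔ span k {x}
    · obtain ⟨y, hyS, hy⟩ := hy
      obtain ⟨p, hp, hp0, hxp, hyp⟩ :=
        exists_common_mem hsq hlow hcap hup hSN h1 hxS hyS hx hy
      refine ⟨p, hp0, fun s hs => ?_⟩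
      by_cases hz : s ∈ span k {(1 : K)} ⊔ span k {x} ⊔ span k {y}
      · refine hle ?_ s hz
        simp only [sup_le_iff, span_singleton_le_iff_mem, mem_comap, LinearMap.mulLeft_apply,
          mul_one]
        exact ⟨⟨hp, by rwa [mul_comm]⟩, by rwa [mul_comm]⟩
      · rw [mul_comm]
        exact mul_common_mem hsq hlow hcap hup hSN h1 hxS hyS hs hx hy hz hp0 hp hxp hyp
    · push Not at hy
      obtain ⟨p, hp, hp0, hxp⟩ := exists_mem_mul_mem hsq hup hSN h1 hxS hx
      refine ⟨p, hp0, fun s hs => hle ?_ s (hy s hs)⟩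
      simp only [sup_le_iff, span_singleton_le_iff_mem, mem_comap, LinearMap.mulLeft_apply,
        mul_one]
      exact ⟨hp, by rwa [mul_comm]⟩
  · push Not at hx
    have hne : S' ≠ ⊥ := by
      rintro rfl
      rw [finrank_bot, finrank_eq_zero] at hdim
      rw [hdim] at h1
      exact one_ne_zero ((mem_bot k).1 h1)
    obtain ⟨p, hp, hp0⟩ := (Submodule.ne_bot_iff _).1 hne
    refine ⟨p, hp0, fun s hs => hle ?_ s (hx s hs)⟩
    simp only [span_singleton_le_iff_mem, mem_comap, LinearMap.mulLeft_apply, mul_one]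
    exact hp

end Minimal

/-! ### Subspaces of small codimension in a field, and spaces of the form P + bS -/

section Neighbor

variable {k K : Type*} [Field k] [Field K] [Algebra k K]

theorem mem_map_mulLeft {S : Submodule k K} {b x : K} :
    x ∈ S.map (LinearMap.mulLeft k b) ↔ ∃ s ∈ S, b * s = x := Iff.rfl

theorem map_mulLeft_mulLeft (S : Submodule k K) (a b : K) :
    (S.map (LinearMap.mulLeft k b)).map (LinearMap.mulLeft k a) =
      S.map (LinearMap.mulLeft k (a * b)) := by
  rw [← Submodule.map_comp, ← LinearMap.mulLeft_mul]

theorem finrank_span_map_mulLeft (M : IntermediateField k K) (S : Submodule k K) {b : K}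
    (hb : b ≠ 0) :
    finrank M (span M (S.map (LinearMap.mulLeft k b) : Set K)) =
      finrank M (span M (S : Set K)) := by
  have h : span M (S.map (LinearMap.mulLeft k b) : Set K) =
      (span M (S : Set K)).map (LinearMap.mulLeft M b) := by
    rw [Submodule.map_span]; rfl
  rw [h]
  exact (LinearEquiv.finrank_eq
    (Submodule.equivMapOfInjective _ (fun _ _ h => mul_left_cancel₀ hb h) _)).symm

theorem mem_of_finrank_span_eq_one (M : IntermediateField k K) {S : Submodule k K}
    [FiniteDimensional k S] (h : finrank M (span M (S : Set K)) = 1) {e : K} (he : e ∈ S)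
    (he0 : e ≠ 0) : ∀ s ∈ S, ∃ α ∈ M, α * e = s := by
  have hle : span M {e} ≤ span M (S : Set K) := by
    rw [span_singleton_le_iff_mem]; exact subset_span he
  have heq := Submodule.eq_of_le_of_finrank_eq hle
    (by rw [finrank_span_singleton he0, h])
  intro s hs
  have : s ∈ span M {e} := by rw [heq]; exact subset_span hs
  obtain ⟨α, rfl⟩ := mem_span_singleton.1 this
  exact ⟨α, α.2, rfl⟩

theorem finrank_span_eq_one (M : IntermediateField k K) {S : Submodule k K} {e : K}
    (hS : S ≠ ⊥) (h : ∀ s ∈ S, ∃ α ∈ M, α * e = s) :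
    finrank M (span M (S : Set K)) = 1 := by
  obtain ⟨s, hs, hs0⟩ := (Submodule.ne_bot_iff _).1 hS
  obtain ⟨α, hα, rfl⟩ := h s hs
  have hα0 := left_ne_zero_of_mul hs0
  have heq : span M (S : Set K) = span M {e} := by
    refine le_antisymm (span_le.2 fun t ht => ?_) ?_
    · obtain ⟨β, hβ, rfl⟩ := h t ht
      exact mem_span_singleton.2 ⟨⟨β, hβ⟩, rfl⟩
    · rw [span_singleton_le_iff_mem]
      have h1 : e = (⟨α⁻¹, inv_mem hα⟩ : M) • (α * e) := by
        change e = α⁻¹ * (α * e); field_simp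
      rw [h1]
      exact smul_mem _ _ (subset_span hs)
  rw [heq, finrank_span_singleton (right_ne_zero_of_mul hs0)]

/-- Two subspaces of codimension at most one of an intermediate field `Q`, up to scaling, which
have the same dimension differ by a scalar. -/
theorem exists_map_mulLeft_eq_of_codim_le_one (Q : IntermediateField k K)
    [FiniteDimensional k Q] (S S' : Submodule k K) [FiniteDimensional k S]
    [FiniteDimensional k S'] {e : K} (he : e ≠ 0) (hS : S ≠ ⊥) (hdim : finrank k S = finrank k S')
    (hSQ : ∀ s ∈ S, ∃ α ∈ Q, α * e = s) (hQ : finrank k Q ≤ finrank k S + 1)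
    (hV : finrank Q (span Q (S : Set K)) = finrank Q (span Q (S' : Set K))) :
    ∃ p ≠ 0, S.map (LinearMap.mulLeft k p) = S' := by
  -- Since `S` spans a line over `Q`, so does `S'`; thus `S'` lies in some Qe'.
  rw [finrank_span_eq_one Q hS hSQ] at hV
  have hSpos : finrank k S ≠ 0 := by
    rwa [Ne, Submodule.finrank_eq_zero]
  have hS' : S' ≠ ⊥ := by
    rintro rfl
    rw [finrank_bot] at hdim
    omega
  obtain ⟨e', he', he'0⟩ := (Submodule.ne_bot_iff _).1 hS'
  have hS'Q := mem_of_finrank_span_eq_one Q hV.symm he' he'0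
  have hfin := finiteDimensional_restrictScalars_span_singleton Q e'
  have hLdim := finrank_restrictScalars_span_singleton Q he'0
  set L := (span Q {e'}).restrictScalars k
  have hle : S' ≤ L := fun s hs => (mem_restrictScalars_span_singleton Q).2 (hS'Q s hs)
  let β : Q →ₗ[k] S →ₗ[k] L := LinearMap.mk₂ k
    (fun q s => ⟨e' / e * q * s, by
      obtain ⟨α, hα, h⟩ := hSQ s s.2
      refine (mem_restrictScalars_span_singleton Q).2 ⟨q * α, mul_mem q.2 hα, ?_⟩
      rw [← h]; field_simp⟩)
    (fun q q' s => Subtype.ext (by simp; ring)) (fun c q s => Subtype.ext (by simp))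
    (fun q s s' => Subtype.ext (by simp; ring)) (fun c q s => Subtype.ext (by simp))
  let γ : Q →ₗ[k] S →ₗ[k] (L ⧸ S'.submoduleOf L) := β.compr₂ (S'.submoduleOf L).mkQ
  have hquot := (S'.submoduleOf L).finrank_quotient_add_finrank
  rw [(submoduleOfEquivOfLe hle).finrank_eq, ← hdim, hLdim] at hquot
  -- The target has dimension 0 if `S'` fills `L`, and dim S = dim Q - 1 otherwise. So some nonzero
  -- q in `Q` induces the zero map, which means that (e'/e)q carries `S` into `S'`.
  have hlt : finrank k (S →ₗ[k] (L ⧸ S'.submoduleOf L)) < finrank k Q := by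
    rw [finrank_linearMap]
    rcases (by omega : finrank k (L ⧸ S'.submoduleOf L) = 0 ∨
      finrank k (L ⧸ S'.submoduleOf L) = 1) with h | h <;> rw [h] at hquot ⊢ <;> omega
  obtain ⟨q, hq, hq0⟩ := (Submodule.ne_bot_iff _).1 (LinearMap.ker_ne_bot_of_finrank_lt hlt)
  have hp0 : e' / e * (q : K) ≠ 0 :=
    mul_ne_zero (div_ne_zero he'0 he) (by simpa using hq0)
  refine ⟨e' / e * q, hp0, map_mulLeft_eq_of_le hp0 hdim fun s hs => ?_⟩
  have h : γ q ⟨s, hs⟩ = 0 := by rw [LinearMap.mem_ker.1 hq]; rfl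
  exact (Submodule.Quotient.mk_eq_zero (S'.submoduleOf L) (x := β q ⟨s, hs⟩)).1 h

/-- The M-spans of P and bS stay inside P and bP, and these meet only in 0 because b ∉ P. -/
theorem finrank_span_sup_map_mulLeft {M P : IntermediateField k K} (hMP : M ≤ P)
    [FiniteDimensional k P] {S : Submodule k K} [FiniteDimensional k S] (hSP : ∀ s ∈ S, s ∈ P)
    {b : K} (hb : b ∉ P) :
    finrank M (span M ((Subalgebra.toSubmodule P.toSubalgebra ⊔
      S.map (LinearMap.mulLeft k b) : Submodule k K) : Set K)) =
      finrank M (span M (P : Set K)) + finrank M (span M (S : Set K)) := by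
  have hb0 : b ≠ 0 := fun h => hb (h ▸ zero_mem P)
  have hsup : span M ((Subalgebra.toSubmodule P.toSubalgebra ⊔
      S.map (LinearMap.mulLeft k b) : Submodule k K) : Set K) =
      span M (P : Set K) ⊔ span M (S.map (LinearMap.mulLeft k b) : Set K) := by
    refine le_antisymm (span_le.2 fun t ht => ?_) (sup_le (span_mono ?_) (span_mono ?_))
    · obtain ⟨x, hx, y, hy, rfl⟩ := mem_sup.1 ht
      exact add_mem (mem_sup_left (subset_span hx)) (mem_sup_right (subset_span hy))
    · exact fun x hx => mem_sup_left (S := Subalgebra.toSubmodule P.toSubalgebra) hx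
    · exact fun x hx => mem_sup_right hx
  have hspan : ∀ {T : Set K}, (∀ t ∈ T, t ∈ P) → ∀ x ∈ span M T, x ∈ P := by
    intro T hT x hx
    induction hx using span_induction with
    | zero => exact zero_mem P
    | add x y _ _ hx hy => exact add_mem hx hy
    | smul c x _ hx => exact mul_mem (hMP c.2) hx
    | mem x hx => exact hT x hx
  have hinf : span M (P : Set K) ⊓ span M (S.map (LinearMap.mulLeft k b) : Set K) = ⊥ := by
    rw [Submodule.eq_bot_iff]
    rintro x ⟨hx1, hx2⟩
    have h : span M (S.map (LinearMap.mulLeft k b) : Set K) =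
        (span M (S : Set K)).map (LinearMap.mulLeft M b) := by
      rw [Submodule.map_span]; rfl
    rw [h] at hx2
    obtain ⟨y, hy, rfl⟩ := hx2
    have hyP : y ∈ P := hspan hSP y hy
    have hbyP : b * y ∈ P := hspan (fun t ht => ht) _ hx1
    by_cases hy0 : y = 0
    · simp [hy0]
    · refine absurd ?_ hb
      have := mul_mem hbyP (inv_mem hyP)
      rwa [mul_assoc, mul_inv_cancel₀ hy0, mul_one] at this
  have : FiniteDimensional k (Subalgebra.toSubmodule P.toSubalgebra) := ‹FiniteDimensional k P›
  have : FiniteDimensional M (span M (P : Set K)) :=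
    finiteDimensional_span_intermediateField M (Subalgebra.toSubmodule P.toSubalgebra)
  have h := finrank_sup_add_finrank_inf_eq (span M (P : Set K))
    (span M (S.map (LinearMap.mulLeft k b) : Set K))
  rw [hinf, finrank_bot, finrank_span_map_mulLeft M S hb0, add_zero] at h
  rw [hsup, h]

theorem exists_eq_sup_map_mulLeft
    (hsq : ∀ x : K, ∃ y : k, algebraMap k K y = x ^ 2)
    (B : Submodule k K) [FiniteDimensional k B] (P : IntermediateField k K)
    [FiniteDimensional k P] (S : Submodule k K) [FiniteDimensional k S]
    (hSP : ∀ s ∈ S, s ∈ P) {b : K} (hb : b ∉ P) (hPB : ∀ x ∈ P, x ∈ B)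
    (hdim : finrank k ↥(Subalgebra.toSubmodule P.toSubalgebra ⊔ S.map (LinearMap.mulLeft k b)) =
      finrank k B)
    (hV : ∀ M : IntermediateField k K,
      finrank M (span M ((Subalgebra.toSubmodule P.toSubalgebra ⊔
        S.map (LinearMap.mulLeft k b) : Submodule k K) : Set K)) =
      finrank M (span M (B : Set K))) :
    ∃ S' : Submodule k K, FiniteDimensional k S' ∧ (∀ s ∈ S', s ∈ P) ∧
      B = Subalgebra.toSubmodule P.toSubalgebra ⊔ S'.map (LinearMap.mulLeft k b) ∧
      finrank k S = finrank k S' ∧ ∀ M ≤ P,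
        finrank M (span M (S : Set K)) = finrank M (span M (S' : Set K)) := by
  have hb0 : b ≠ 0 := fun h => hb (h ▸ zero_mem P)
  have hfinP : FiniteDimensional k (Subalgebra.toSubmodule P.toSubalgebra) :=
    ‹FiniteDimensional k P›
  have hsqP : ∀ x : K, ∃ y : P, algebraMap P K y = x ^ 2 := fun x => by
    obtain ⟨y, hy⟩ := hsq x
    exact ⟨algebraMap k P y, by rw [← hy, ← IsScalarTower.algebraMap_apply]⟩
  -- Over N = P(b) = P + Pb the space P + bS spans a line. Hence so does `B`, and as 1 ∈ `B` this
  -- gives `B` ⊆ N.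
  let N : IntermediateField k K := (IntermediateField.adjoin P {b}).restrictScalars k
  have hN : ∀ x, x ∈ N ↔ ∃ a c : P, x = a + c * b :=
    IntermediateField.mem_adjoin_simple_iff_of_sq hsqP b
  have hone : finrank N (span N ((Subalgebra.toSubmodule P.toSubalgebra ⊔
      S.map (LinearMap.mulLeft k b) : Submodule k K) : Set K)) = 1 := by
    refine finrank_span_eq_one N (e := 1) ?_ fun x hx => ⟨x, ?_, mul_one x⟩
    · exact (Submodule.ne_bot_iff _).2 ⟨1, mem_sup_left (one_mem P), one_ne_zero⟩
    · obtain ⟨a, ha, _, ⟨s, hs, rfl⟩, rfl⟩ := mem_sup.1 hx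
      exact (hN _).2 ⟨⟨a, ha⟩, ⟨s, hSP s hs⟩, by simp [mul_comm]⟩
  rw [hV N] at hone
  have hBN : ∀ x ∈ B, ∃ a c : P, x = a + c * b := fun x hx => by
    obtain ⟨α, hα, rfl⟩ :=
      mem_of_finrank_span_eq_one N hone (hPB 1 (one_mem P)) one_ne_zero x hx
    rw [mul_one]
    exact (hN α).1 hα
  let S' : Submodule k K :=
    Subalgebra.toSubmodule P.toSubalgebra ⊓ B.comap (LinearMap.mulLeft k b)
  have hS'P : ∀ s ∈ S', s ∈ P := fun s hs => hs.1
  have hfinS' : FiniteDimensional k S' := Submodule.finiteDimensional_inf_left _ _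
  have hB : B = Subalgebra.toSubmodule P.toSubalgebra ⊔ S'.map (LinearMap.mulLeft k b) := by
    refine le_antisymm (fun x hx => ?_) (sup_le hPB ?_)
    · obtain ⟨a, c, rfl⟩ := hBN x hx
      refine add_mem (mem_sup_left a.2) (mem_sup_right ⟨c, ⟨c.2, ?_⟩, mul_comm _ _⟩)
      change b * c ∈ B
      have := sub_mem hx (hPB a a.2)
      rwa [add_sub_cancel_left, mul_comm] at this
    · rintro _ ⟨s, hs, rfl⟩
      exact hs.2
  have hsplit : ∀ T : Submodule k K, FiniteDimensional k T → (∀ t ∈ T, t ∈ P) →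
      finrank k ↥(Subalgebra.toSubmodule P.toSubalgebra ⊔ T.map (LinearMap.mulLeft k b)) =
        finrank k P + finrank k T := by
    intro T hT hTP
    have h := finrank_sup_add_finrank_inf_eq (Subalgebra.toSubmodule P.toSubalgebra)
      (T.map (LinearMap.mulLeft k b))
    have hinf : Subalgebra.toSubmodule P.toSubalgebra ⊓ T.map (LinearMap.mulLeft k b) = ⊥ := by
      rw [Submodule.eq_bot_iff]
      rintro _ ⟨hx, t, ht, rfl⟩
      by_cases ht0 : t = 0
      · simp [ht0]
      · refine absurd ?_ hb
        have : b * t * t⁻¹ ∈ P := mul_mem hx (inv_mem (hTP t ht))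
        rwa [mul_assoc, mul_inv_cancel₀ ht0, mul_one] at this
    rw [hinf, finrank_bot, add_zero, finrank_map_mulLeft T hb0] at h
    exact h
  refine ⟨S', hfinS', hS'P, hB, ?_, fun M hM => ?_⟩
  · have h1 := hsplit S ‹_› hSP
    have h2 := hsplit S' hfinS' hS'P
    rw [← hB] at h2
    omega
  · have h1 := finrank_span_sup_map_mulLeft hM hSP hb
    have h2 := finrank_span_sup_map_mulLeft hM hS'P hb
    rw [← hB] at h2
    have h3 := hV M
    omega

theorem exists_map_mulLeft_eq_of_special
    (hsq : ∀ x : K, ∃ y : k, algebraMap k K y = x ^ 2)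
    (B : Submodule k K) [FiniteDimensional k B] (P : IntermediateField k K)
    [FiniteDimensional k P] (S : Submodule k K) [FiniteDimensional k S]
    (hSP : ∀ s ∈ S, s ∈ P) {b : K} (hb : b ∉ P) (hPB : ∀ x ∈ P, x ∈ B)
    (hdim : finrank k ↥(Subalgebra.toSubmodule P.toSubalgebra ⊔ S.map (LinearMap.mulLeft k b)) =
      finrank k B)
    (hV : ∀ M : IntermediateField k K,
      finrank M (span M ((Subalgebra.toSubmodule P.toSubalgebra ⊔
        S.map (LinearMap.mulLeft k b) : Submodule k K) : Set K)) =
      finrank M (span M (B : Set K)))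
    (hS : (∃ (Q : IntermediateField k K) (e : K), FiniteDimensional k Q ∧ e ≠ 0 ∧
        (∀ s ∈ S, ∃ α ∈ Q, α * e = s) ∧ finrank k Q ≤ finrank k S + 1 ∧
        finrank k Q < 2 * finrank k S) ∨
      ∃ s ∈ S, s ≠ 0 ∧ 2 ^ finrank k S ≤ 2 * finrank k
        (IntermediateField.adjoin k (S.map (LinearMap.mulLeft k s⁻¹) : Set K))) :
    ∃ p ≠ 0, (Subalgebra.toSubmodule P.toSubalgebra ⊔ S.map (LinearMap.mulLeft k b)).map
      (LinearMap.mulLeft k p) = B := by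
  obtain ⟨S', hfin', hS'P, hB, hdimS, hVS⟩ :=
    exists_eq_sup_map_mulLeft hsq B P S hSP hb hPB hdim hV
  have hSne : S ≠ ⊥ := by
    rcases hS with ⟨Q, e, -, -, -, -, h⟩ | ⟨s, hs, hs0, -⟩
    · rintro rfl
      rw [finrank_bot] at h
      omega
    · exact (Submodule.ne_bot_iff _).2 ⟨s, hs, hs0⟩
  obtain ⟨p, hp0, hp⟩ : ∃ p ≠ 0, S.map (LinearMap.mulLeft k p) = S' := by
    rcases hS with ⟨Q, e, hQfin, he0, hSQ, hQ1, hQ2⟩ | ⟨s, hs, hs0, hmin⟩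
    · obtain ⟨s₀, hs₀, hs₀0⟩ := (Submodule.ne_bot_iff _).1 hSne
      have hle : S.map (LinearMap.mulLeft k s₀⁻¹) ≤
          Subalgebra.toSubmodule (Q ⊓ P).toSubalgebra := by
        rintro _ ⟨s, hs, rfl⟩
        refine ⟨?_, mul_mem (inv_mem (hSP s₀ hs₀)) (hSP s hs)⟩
        obtain ⟨α, hα, h⟩ := hSQ s hs
        obtain ⟨α₀, hα₀, h₀⟩ := hSQ s₀ hs₀
        have hα₀0 : α₀ ≠ 0 := fun h => hs₀0 (by rw [← h₀, h, zero_mul])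
        have : s₀⁻¹ * s = α₀⁻¹ * α := by rw [← h, ← h₀]; field_simp
        rw [LinearMap.mulLeft_apply, this]
        exact mul_mem (inv_mem hα₀) hα
      have hle' : Q ⊓ P ≤ Q := inf_le_left
      have hQPfin : FiniteDimensional k ↥(Q ⊓ P) :=
        FiniteDimensional.of_injective (IntermediateField.inclusion hle').toLinearMap
          (IntermediateField.inclusion_injective hle')
      have hQPfin' : FiniteDimensional k (Subalgebra.toSubmodule (Q ⊓ P).toSubalgebra) := hQPfin
      have h1 := Submodule.finrank_mono hle
      rw [finrank_map_mulLeft S (inv_ne_zero hs₀0)] at h1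
      have h1' : finrank k S ≤ finrank k ↥(Q ⊓ P) := h1
      -- A scalar multiple of `S` lies in Q ∩ P, so this subfield has more than half the dimension
      -- of Q, and its degree divides that of Q. Thus Q ≤ P, and the span condition is available for
      -- Q.
      have hQP : Q ⊓ P = Q := by
        refine IntermediateField.eq_of_le_of_finrank_eq hle' ?_
        obtain ⟨m, hm⟩ := IntermediateField.finrank_dvd_of_le_right hle'
        have hpos : 0 < finrank k Q := finrank_pos
        rcases (by omega : m = 0 ∨ m = 1 ∨ 2 ≤ m) with rfl | rfl | hm2
        · omega
        · omega
        · nlinarith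
      exact exists_map_mulLeft_eq_of_codim_le_one Q S S' he0 hSne hdimS hSQ hQ1
        (hVS Q (inf_eq_left.1 hQP))
    · set S₁ := S.map (LinearMap.mulLeft k s⁻¹)
      have hs0' := inv_ne_zero hs0
      have hadj : IntermediateField.adjoin k (S₁ : Set K) ≤ P := by
        rw [IntermediateField.adjoin_le_iff]
        rintro _ ⟨t, ht, rfl⟩
        exact mul_mem (inv_mem (hSP s hs)) (hSP t ht)
      obtain ⟨p, hp0, hp⟩ := exists_map_mulLeft_eq_of_minimal hsq S₁ S'
        ⟨s, hs, by simp [hs0]⟩ (by rw [finrank_map_mulLeft S hs0', hdimS])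
        (by rwa [finrank_map_mulLeft S hs0']) fun M hM => by
          rw [finrank_span_map_mulLeft M S hs0']
          exact hVS M (hM.trans hadj)
      exact ⟨p * s⁻¹, mul_ne_zero hp0 hs0', by rw [← map_mulLeft_mulLeft, hp]⟩
  have hpP : p ∈ P := by
    obtain ⟨s, hs, hs0⟩ := (Submodule.ne_bot_iff _).1 hSne
    have h : p * s ∈ S' := by rw [← hp]; exact ⟨s, hs, rfl⟩
    have := mul_mem (hS'P _ h) (inv_mem (hSP s hs))
    rwa [mul_assoc, mul_inv_cancel₀ hs0, mul_one] at this
  refine ⟨p, hp0, ?_⟩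
  have hPP : (Subalgebra.toSubmodule P.toSubalgebra).map (LinearMap.mulLeft k p) =
      Subalgebra.toSubmodule P.toSubalgebra :=
    map_mulLeft_eq_of_le hp0 rfl fun x (hx : x ∈ P) => (mul_mem hpP hx : p * x ∈ P)
  rw [Submodule.map_sup, hPP, map_mulLeft_mulLeft, mul_comm, ← map_mulLeft_mulLeft, hp, hB]

end Neighbor

/-- Rank-nullity for a map that is semilinear along a field isomorphism; it serves forms, which are
linear only up to Frobenius. -/
theorem finrank_eq_add_of_semilinear {R R' V V' : Type*} [Field R] [Field R'] [AddCommGroup V]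
    [Module R V] [AddCommGroup V'] [Module R' V'] [FiniteDimensional R V] (e : R ≃+* R')
    (g : V →ₛₗ[(e : R →+* R')] V') (N : Submodule R V) (hN : ∀ v, v ∈ N ↔ g v = 0)
    (U : Submodule R' V') (hU : ∀ u, u ∈ U ↔ ∃ v, g v = u) :
    finrank R V = finrank R N + finrank R' U := by
  have hmem : ∀ q : V ⧸ N, N.liftQ g (fun v hv => (hN v).1 hv) q ∈ U := fun q => by
    obtain ⟨v, rfl⟩ := Submodule.mkQ_surjective _ q
    exact (hU _).2 ⟨v, rfl⟩
  let j : (V ⧸ N) →+ U :=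
    { toFun := fun q => ⟨N.liftQ g (fun v hv => (hN v).1 hv) q, hmem q⟩
      map_zero' := Subtype.ext (map_zero _)
      map_add' := fun a b => Subtype.ext (map_add _ a b) }
  have hj : Function.Bijective j := by
    constructor
    · rw [injective_iff_map_eq_zero]
      intro q hq
      obtain ⟨v, rfl⟩ := Submodule.mkQ_surjective _ q
      rw [Submodule.mkQ_apply, Submodule.Quotient.mk_eq_zero, hN]
      exact congrArg Subtype.val hq
    · rintro ⟨u, hu⟩
      obtain ⟨v, rfl⟩ := (hU u).1 hu
      exact ⟨N.mkQ v, rfl⟩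
  have h := lift_rank_eq_of_equiv_equiv (R := R) (R' := R') (M := V ⧸ N) (M' := U) e
    (AddEquiv.ofBijective j hj) e.bijective (fun r q => Subtype.ext (map_smulₛₗ _ r q))
  have h2 : finrank R (V ⧸ N) = finrank R' U := by
    have := congrArg Cardinal.toNat h
    rwa [Cardinal.toNat_lift, Cardinal.toNat_lift] at this
  rw [← N.finrank_quotient_add_finrank, h2, add_comm]

namespace TSForm

/-! ### The space of values of a form -/

section Values

variable {F : Type u} [Field F] [CharP F 2]
variable {V : Type v} [AddCommGroup V] [Module F V]
variable {W : Type w} [AddCommGroup W] [Module F W]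

theorem exists_algebraMap_eq_sq (x : F) :
    ∃ y : (frobenius F 2).fieldRange, algebraMap (frobenius F 2).fieldRange F y = x ^ 2 :=
  ⟨⟨x ^ 2, x, rfl⟩, rfl⟩

/-- The set of values `D_F(φ)`, as a vector space over `F²`. -/
def valueSpace (φ : TSForm F V) : Submodule (frobenius F 2).fieldRange F where
  carrier := Set.range φ
  add_mem' := by
    rintro _ _ ⟨v, rfl⟩ ⟨w, rfl⟩
    exact ⟨v + w, map_add _ _ _⟩
  zero_mem' := ⟨0, map_zero _⟩
  smul_mem' := by
    rintro ⟨_, a, rfl⟩ _ ⟨v, rfl⟩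
    exact ⟨a • v, apply_smul φ a v⟩

theorem mem_valueSpace {φ : TSForm F V} {a : F} : a ∈ φ.valueSpace ↔ ∃ v, φ v = a := Iff.rfl

theorem finrank_eq_defect_add_finrank_valueSpace [FiniteDimensional F V] (φ : TSForm F V) :
    finrank F V = φ.defect + finrank (frobenius F 2).fieldRange φ.valueSpace :=
  finrank_eq_add_of_semilinear (frobenius F 2).rangeRestrictFieldEquiv
    { toFun := φ, map_add' := map_add φ, map_smul' := fun a v => apply_smul φ a v }
    _ (fun _ => LinearMap.mem_ker) _ (fun _ => Iff.rfl)

instance finiteDimensional_valueSpace [FiniteDimensional F V] (φ : TSForm F V) :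
    FiniteDimensional (frobenius F 2).fieldRange φ.valueSpace := by
  let g : V →ₛₗ[((frobenius F 2).rangeRestrictFieldEquiv : F →+* (frobenius F 2).fieldRange)]
      φ.valueSpace :=
    { toFun := fun v => ⟨φ v, v, rfl⟩
      map_add' := fun v w => Subtype.ext (map_add φ v w)
      map_smul' := fun a v => Subtype.ext (apply_smul φ a v) }
  have : RingHomSurjective
      ((frobenius F 2).rangeRestrictFieldEquiv : F →+* (frobenius F 2).fieldRange) :=
    ⟨(frobenius F 2).rangeRestrictFieldEquiv.surjective⟩
  refine Module.Finite.of_surjective g ?_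
  rintro ⟨_, v, rfl⟩
  exact ⟨v, rfl⟩

theorem Anisotropic.finrank_valueSpace [FiniteDimensional F V] {φ : TSForm F V}
    (hφ : φ.Anisotropic) : finrank (frobenius F 2).fieldRange φ.valueSpace = finrank F V := by
  have h : φ.defect = 0 := by
    rw [defect, Submodule.finrank_eq_zero, Submodule.eq_bot_iff]
    exact fun v hv => hφ v hv
  rw [φ.finrank_eq_defect_add_finrank_valueSpace, h, zero_add]

theorem Isometric.valueSpace_eq {φ : TSForm F V} {ψ : TSForm F W} (h : Isometric φ ψ) :
    φ.valueSpace = ψ.valueSpace := by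
  obtain ⟨f, hf⟩ := h
  ext a
  constructor
  · rintro ⟨v, rfl⟩; exact ⟨f v, (hf v).symm⟩
  · rintro ⟨v, rfl⟩; exact ⟨f.symm v, by rw [hf, f.apply_symm_apply]⟩

theorem IsSubform.valueSpace_le {φ : TSForm F V} {ψ : TSForm F W} (h : IsSubform φ ψ) :
    φ.valueSpace ≤ ψ.valueSpace := by
  obtain ⟨f, -, hf⟩ := h
  rintro _ ⟨v, rfl⟩
  exact ⟨f v, (hf v).symm⟩

theorem valueSpace_smul (c : F) (φ : TSForm F V) :
    (c • φ).valueSpace = φ.valueSpace.map (LinearMap.mulLeft _ c) := by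
  ext a
  constructor
  · rintro ⟨v, rfl⟩; exact ⟨φ v, ⟨v, rfl⟩, rfl⟩
  · rintro ⟨_, ⟨v, rfl⟩, rfl⟩; exact ⟨v, rfl⟩

theorem valueSpace_orthSum (φ : TSForm F V) (ψ : TSForm F W) :
    (orthSum φ ψ).valueSpace = φ.valueSpace ⊔ ψ.valueSpace := by
  ext a
  rw [mem_sup]
  constructor
  · rintro ⟨v, rfl⟩; exact ⟨_, ⟨v.1, rfl⟩, _, ⟨v.2, rfl⟩, rfl⟩
  · rintro ⟨_, ⟨v, rfl⟩, _, ⟨w, rfl⟩, rfl⟩; exact ⟨(v, w), rfl⟩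

theorem valueSpace_anisotropicPart (φ : TSForm F V) :
    φ.anisotropicPart.valueSpace = φ.valueSpace := by
  ext a
  constructor
  · rintro ⟨q, rfl⟩
    obtain ⟨v, rfl⟩ := Submodule.mkQ_surjective _ q
    exact ⟨v, rfl⟩
  · rintro ⟨v, rfl⟩; exact ⟨Submodule.mkQ _ v, rfl⟩

theorem valueSpace_diag {ι : Type w} [Fintype ι] (a : ι → F) :
    (diag a).valueSpace = span (frobenius F 2).fieldRange (Set.range a) := by
  classical
  refine le_antisymm ?_ (span_le.2 ?_)
  · rintro _ ⟨t, rfl⟩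
    refine sum_mem fun i _ => ?_
    rw [mul_comm]
    exact smul_mem (span (frobenius F 2).fieldRange (Set.range a))
      (⟨t i ^ 2, t i, rfl⟩ : (frobenius F 2).fieldRange) (subset_span ⟨i, rfl⟩)
  · rintro _ ⟨i, rfl⟩
    refine ⟨Pi.single i 1, ?_⟩
    change ∑ j, a j * (Pi.single i (1 : F) : ι → F) j ^ 2 = a i
    rw [Finset.sum_eq_single i] <;> simp +contextual

theorem exists_intermediateField_eq_valueSpace_pfister {n : ℕ} (a : Fin n → F) :
    ∃ Q : IntermediateField (frobenius F 2).fieldRange F,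
      Subalgebra.toSubmodule Q.toSubalgebra = (pfister a).valueSpace := by
  rw [pfister, valueSpace_diag]
  exact exists_intermediateField_eq_span exists_algebraMap_eq_sq a

theorem IsQuasiPfister.exists_intermediateField {φ : TSForm F V} (h : φ.IsQuasiPfister) :
    ∃ Q : IntermediateField (frobenius F 2).fieldRange F,
      Subalgebra.toSubmodule Q.toSubalgebra = φ.valueSpace := by
  obtain ⟨n, a, h⟩ := h
  rw [h.valueSpace_eq]
  exact exists_intermediateField_eq_valueSpace_pfister a

/-- Forms of the same dimension with the same values are isometric. -/
theorem isometric_of_valueSpace_eq [FiniteDimensional F V] [FiniteDimensional F W]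
    {φ : TSForm F V} {ψ : TSForm F W} (hdim : finrank F V = finrank F W)
    (h : φ.valueSpace = ψ.valueSpace) : Isometric φ ψ := by
  have hφ := φ.finrank_eq_defect_add_finrank_valueSpace
  have hψ := ψ.finrank_eq_defect_add_finrank_valueSpace
  have hdef : φ.defect = ψ.defect := by rw [h] at hφ; omega
  -- An anisotropic form is additive with trivial kernel, hence injective, so matching equal values
  -- is automatically a linear map between the anisotropic parts.
  have hinj : ∀ a b, ψ.anisotropicPart a = ψ.anisotropicPart b → a = b := fun a b hab => by
    rw [← sub_eq_zero]
    exact ψ.anisotropic_anisotropicPart _ (by rw [map_sub, hab, sub_self])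
  have hex : ∀ a, ∃ b, ψ.anisotropicPart b = φ.anisotropicPart a := fun a => by
    have : φ.anisotropicPart a ∈ ψ.anisotropicPart.valueSpace := by
      rw [valueSpace_anisotropicPart, ← h, ← valueSpace_anisotropicPart]
      exact ⟨a, rfl⟩
    exact this
  choose f hf using hex
  let f' : (V ⧸ LinearMap.ker φ) →ₗ[F] (W ⧸ LinearMap.ker ψ) :=
    { toFun := f
      map_add' := fun a b => hinj _ _ (by rw [map_add, hf, hf, hf, map_add])
      map_smul' := fun c a => hinj _ _ (by
        rw [RingHom.id_apply, apply_smul, hf, hf, apply_smul]) }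
  have hbij : Function.Bijective f' := by
    constructor
    · rw [injective_iff_map_eq_zero]
      intro a ha
      refine φ.anisotropic_anisotropicPart a ?_
      rw [← hf]
      exact (congrArg ψ.anisotropicPart ha).trans (map_zero _)
    · intro b
      have : ψ.anisotropicPart b ∈ φ.anisotropicPart.valueSpace := by
        rw [valueSpace_anisotropicPart, h, ← valueSpace_anisotropicPart]
        exact ⟨b, rfl⟩
      obtain ⟨a, ha⟩ := this
      exact ⟨a, hinj _ _ ((hf a).trans ha)⟩
  obtain ⟨g₁, hg₁⟩ := φ.isometric_anisotropicPart_orthSum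
  obtain ⟨g₂, hg₂⟩ := ψ.isometric_anisotropicPart_orthSum
  let e := (LinearEquiv.ofBijective f' hbij).prodCongr
    (LinearEquiv.funCongrLeft F F (finCongr hdef.symm))
  refine ⟨(g₁.trans e).trans g₂.symm, fun v => ?_⟩
  rw [hg₁ v, hg₂]
  simp only [LinearEquiv.trans_apply, LinearEquiv.apply_symm_apply]
  simp only [orthSum, diag, LinearMap.coe_mk, AddHom.coe_mk, zero_mul, Finset.sum_const_zero,
    add_zero]
  exact (hf _).symm

end Values

/-! ### Defects over extensions as dimensions of spans -/

section Extension

variable {F : Type u} [Field F] [CharP F 2]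
variable {V : Type v} [AddCommGroup V] [Module F V]
variable {W : Type w} [AddCommGroup W] [Module F W]

/-- If `e : E ≃ M` is such that `F ⊆ E` corresponds to `F² ⊆ M ⊆ K`, the defect of `φ_E` is
determined by the dimension of the `M`-span of the values of `φ` in `K`. -/
theorem finrank_eq_defect_baseChange_add [FiniteDimensional F V] (φ : TSForm F V)
    {E : Type y} [Field E] [Algebra F E] [CharP E 2] {M : Type z} [Field M] {K : Type x} [Field K]
    [CharP K 2] [Algebra F K] [Algebra M K] (e : E ≃+* M)
    (he : ∀ a : F, algebraMap M K (e (algebraMap F E a)) = algebraMap F K a ^ 2) :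
    finrank F V = (φ.baseChange E).defect +
      finrank M (span M (Set.range fun v => algebraMap F K (φ v))) := by
  let g₀ : E ⊗[F] V →+ K := TensorProduct.liftAddHom
    (AddMonoidHom.mk' (fun a => AddMonoidHom.mk'
        (fun v => algebraMap M K (e a) * algebraMap F K (φ v))
        (fun v v' => by rw [map_add, map_add, mul_add]))
      (fun a a' => by
        ext v
        simp only [AddMonoidHom.mk'_apply, AddMonoidHom.add_apply, map_add, add_mul]))
    (fun r a v => by
      simp only [AddMonoidHom.mk'_apply, apply_smul, Algebra.smul_def, map_mul, map_pow, he]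
      ring)
  have hg₀ : ∀ a v, g₀ (a ⊗ₜ v) = algebraMap M K (e a) * algebraMap F K (φ v) :=
    fun _ _ => rfl
  let g : E ⊗[F] V →ₛₗ[(e : E →+* M)] K :=
    { toFun := g₀
      map_add' := map_add g₀
      map_smul' := fun a t => by
        induction t with
        | zero => simp
        | add t t' ht ht' => rw [smul_add, map_add, map_add, ht, ht', smul_add]
        | tmul b v =>
          rw [TensorProduct.smul_tmul', smul_eq_mul, hg₀, hg₀, map_mul, map_mul, mul_assoc,
            Algebra.smul_def]
          rfl }
  have hg : ∀ a v, g (a ⊗ₜ v) = algebraMap M K (e a) * algebraMap F K (φ v) := hg₀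
  -- `e` plays the role of squaring E → E² = M. So `g` has the same kernel as φ_E, and its image is
  -- the M-span of the values.
  have hsq : ∀ t, g t ^ 2 = algebraMap M K (e (φ.baseChange E t)) := by
    intro t
    induction t with
    | zero => simp
    | add t t' ht ht' => rw [map_add, CharTwo.add_sq, ht, ht', map_add, map_add, map_add]
    | tmul a v => rw [hg, baseChange_tmul, map_mul, map_mul, he, map_pow, map_pow, mul_pow]
  have h := finrank_eq_add_of_semilinear e g (LinearMap.ker (φ.baseChange E)) (fun t => by
      rw [LinearMap.mem_ker, ← pow_eq_zero_iff (two_ne_zero) (a := g t), hsq]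
      simp) (span M (Set.range fun v => algebraMap F K (φ v))) (fun u => by
      constructor
      · intro hu
        induction hu using span_induction with
        | zero => exact ⟨0, map_zero _⟩
        | add x y _ _ hx hy =>
          obtain ⟨t, rfl⟩ := hx
          obtain ⟨t', rfl⟩ := hy
          exact ⟨t + t', map_add _ _ _⟩
        | smul c x _ hx =>
          obtain ⟨t, rfl⟩ := hx
          exact ⟨e.symm c • t, by rw [map_smulₛₗ]; simp⟩
        | mem x hx =>
          obtain ⟨v, rfl⟩ := hx
          exact ⟨1 ⊗ₜ v, by rw [hg]; simp⟩
      · rintro ⟨t, rfl⟩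
        induction t with
        | zero => simp
        | add t t' ht ht' => rw [map_add]; exact add_mem ht ht'
        | tmul a v =>
          rw [hg, ← Algebra.smul_def]
          exact smul_mem _ _ (subset_span ⟨v, rfl⟩))
  rwa [finrank_baseChange] at h

/-- M becomes an extension of F through a ↦ a², so that it stands for the field M^(1/2). Vishik
equivalence tests only fields in the universe of F, so M is replaced by a small copy. -/
theorem VishikEquivalent.finrank_span_eq [FiniteDimensional F V] [FiniteDimensional F W]
    {φ : TSForm F V} {ψ : TSForm F W} (h : VishikEquivalent φ ψ)
    {K : Type x} [Field K] [CharP K 2] [Algebra F K]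
    (M : Type z) [Field M] [Algebra M K] [Small.{u} M]
    (hM : ∀ a : F, ∃ m : M, algebraMap M K m = algebraMap F K a ^ 2) :
    finrank M (span M (Set.range fun v => algebraMap F K (φ v))) =
      finrank M (span M (Set.range fun v => algebraMap F K (ψ v))) := by
  choose i hi using hM
  have hinj := (algebraMap M K).injective
  let i' : F →+* M :=
    { toFun := i
      map_one' := hinj (by rw [hi]; simp)
      map_zero' := hinj (by rw [hi]; simp)
      map_mul' := fun a b => hinj (by simp only [hi, map_mul, mul_pow])
      map_add' := fun a b => hinj (by simp only [hi, map_add, CharTwo.add_sq]) }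
  let e : Shrink.{u} M ≃+* M := Shrink.ringEquiv M
  let _ : Algebra F (Shrink.{u} M) := ((e.symm : M →+* Shrink.{u} M).comp i').toAlgebra
  have : CharP (Shrink.{u} M) 2 :=
    (i'.charP_iff i'.injective 2).1 ‹_› |> fun h =>
      ((e : Shrink.{u} M →+* M).charP_iff e.injective 2).2 h
  have he : ∀ a : F, algebraMap M K (e (algebraMap F (Shrink.{u} M) a)) =
      algebraMap F K a ^ 2 := fun a => by
    have : algebraMap F (Shrink.{u} M) a = e.symm (i a) := rfl
    rw [this, e.apply_symm_apply, hi]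
  have h1 := φ.finrank_eq_defect_baseChange_add e he
  have h2 := ψ.finrank_eq_defect_baseChange_add e he
  have h3 := h.2 (Shrink.{u} M)
  have h4 := h.1
  omega

theorem valueSpace_baseChange (φ : TSForm F V) (K : Type x) [Field K] [CharP K 2] [Algebra F K] :
    (φ.baseChange K).valueSpace =
      span (frobenius K 2).fieldRange (Set.range fun v => algebraMap F K (φ v)) := by
  refine le_antisymm ?_ (span_le.2 ?_)
  · rintro _ ⟨t, rfl⟩
    induction t with
    | zero => simp
    | add t t' ht ht' => rw [map_add]; exact add_mem ht ht'
    | tmul a v =>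
      rw [baseChange_tmul]
      exact smul_mem (span (frobenius K 2).fieldRange (Set.range fun v => algebraMap F K (φ v)))
        (⟨a ^ 2, a, rfl⟩ : (frobenius K 2).fieldRange) (subset_span ⟨v, rfl⟩)
  · rintro _ ⟨v, rfl⟩
    exact ⟨1 ⊗ₜ v, by rw [baseChange_tmul]; simp⟩

omit [CharP F 2] in
-- Squaring is injective in characteristic 2 and here embeds K into the image of F.
theorem small_of_sq_mem {K : Type x} [Field K] [CharP K 2] [Algebra F K] {G : Set F}
    (hK : Set.range (fun z : K => z ^ 2) = algebraMap F K '' G) : Small.{u} K := by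
  have h : ∀ a : K, ∃ b : F, algebraMap F K b = a ^ 2 := fun a => by
    have : a ^ 2 ∈ algebraMap F K '' G := by rw [← hK]; exact ⟨a, rfl⟩
    obtain ⟨b, -, hb⟩ := this
    exact ⟨b, hb⟩
  choose f hf using h
  refine small_of_injective (f := f) fun a b hab => ?_
  refine frobenius_inj K 2 ?_
  rw [frobenius_def, frobenius_def, ← hf, ← hf, hab]

/-- Over a field `K` with `K² = G_F(φ)` the form `φ` gains no values. -/
theorem mem_valueSpace_baseChange_iff (φ : TSForm F V) {K : Type x} [Field K] [CharP K 2]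
    [Algebra F K]
    (hK : Set.range (fun z : K => z ^ 2) = algebraMap F K '' φ.similarityFactors) (a : K) :
    a ∈ (φ.baseChange K).valueSpace ↔ ∃ v, algebraMap F K (φ v) = a := by
  constructor
  · rw [valueSpace_baseChange]
    intro ha
    induction ha using span_induction with
    | zero => exact ⟨0, by simp⟩
    | add x y _ _ hx hy =>
      obtain ⟨v, rfl⟩ := hx
      obtain ⟨w, rfl⟩ := hy
      exact ⟨v + w, by simp⟩
    | smul c x _ hx =>
      obtain ⟨v, rfl⟩ := hx
      obtain ⟨_, d, rfl⟩ := c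
      -- A nonzero scalar d² comes from a similarity factor of φ, so an isometry realizes its
      -- multiple of a value as a value.
      have : d ^ 2 ∈ algebraMap F K '' φ.similarityFactors := by rw [← hK]; exact ⟨d, rfl⟩
      obtain ⟨g, hg, hgd⟩ := this
      rcases hg with ⟨hg0, f, hf⟩ | rfl
      · refine ⟨f v, ?_⟩
        rw [← hf, LinearMap.smul_apply, smul_eq_mul, map_mul, hgd]
        rfl
      · refine ⟨0, ?_⟩
        rw [map_zero] at hgd ⊢
        change _ = d ^ 2 * _
        rw [← hgd, map_zero, zero_mul]
    | mem x hx => exact hx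
  · rintro ⟨v, rfl⟩
    exact ⟨1 ⊗ₜ v, by rw [baseChange_tmul]; simp⟩

end Extension

end TSForm

namespace TSForm

/-! ### The three types of σ in terms of values -/

section Special

variable {K : Type x} [Field K] [CharP K 2]
variable {P : Type y} [AddCommGroup P] [Module K P]
variable {S : Type z} [AddCommGroup S] [Module K S] [FiniteDimensional K S]

theorem normDegree_le_finrank_adjoin (σ : TSForm K S) {s : K} (hs : s ∈ σ.valueSpace)
    (hs0 : s ≠ 0) :
    σ.normDegree ≤ finrank (frobenius K 2).fieldRange (IntermediateField.adjoin
      (frobenius K 2).fieldRange (σ.valueSpace.map (LinearMap.mulLeft _ s⁻¹) : Set K)) := by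
  -- `Q` serves only to make the adjoined field finite-dimensional: `finrank` is 0 in infinite
  -- dimension and would not be monotone.
  obtain ⟨Q, hQ, hQfin, -⟩ := exists_intermediateField_ge exists_algebraMap_eq_sq
    (σ.valueSpace.map (LinearMap.mulLeft _ s⁻¹)) ⟨s, hs, by simp [hs0]⟩
  have hle : σ.normField ≤ IntermediateField.adjoin (frobenius K 2).fieldRange
      (σ.valueSpace.map (LinearMap.mulLeft _ s⁻¹) : Set K) := by
    refine IntermediateField.adjoin_le_iff.2 ?_
    rintro _ ⟨a, ⟨ha, -⟩, b, ⟨hb, -⟩, rfl⟩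
    rw [show a / b = s⁻¹ * a * (s⁻¹ * b)⁻¹ by field_simp]
    exact mul_mem (IntermediateField.subset_adjoin _ _ ⟨a, ha, rfl⟩)
      (inv_mem (IntermediateField.subset_adjoin _ _ ⟨b, hb, rfl⟩))
  have hle' : IntermediateField.adjoin (frobenius K 2).fieldRange
      (σ.valueSpace.map (LinearMap.mulLeft _ s⁻¹) : Set K) ≤ Q :=
    IntermediateField.adjoin_le_iff.2 fun t ht => hQ t ht
  have := FiniteDimensional.of_injective (IntermediateField.inclusion hle').toLinearMap
    (IntermediateField.inclusion_injective hle')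
  exact LinearMap.finrank_le_finrank_of_injective
    (f := (IntermediateField.inclusion hle).toLinearMap) (IntermediateField.inclusion_injective hle)

theorem finrank_pos_and_valueSpace_cases {σ : TSForm K S} (haniso : σ.Anisotropic)
    (hσ : σ.IsQuasiPfister ∨ σ.IsQuasiPfisterNeighborOfCodim 1 ∨ σ.IsMinimal) :
    0 < finrank K S ∧
    ((∃ (Q : IntermediateField (frobenius K 2).fieldRange K) (e : K),
        FiniteDimensional (frobenius K 2).fieldRange Q ∧ e ≠ 0 ∧
        (∀ s ∈ σ.valueSpace, ∃ α ∈ Q, α * e = s) ∧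
        finrank (frobenius K 2).fieldRange Q ≤
          finrank (frobenius K 2).fieldRange σ.valueSpace + 1 ∧
        finrank (frobenius K 2).fieldRange Q <
          2 * finrank (frobenius K 2).fieldRange σ.valueSpace) ∨
      ∃ s ∈ σ.valueSpace, s ≠ 0 ∧ 2 ^ finrank (frobenius K 2).fieldRange σ.valueSpace ≤
        2 * finrank (frobenius K 2).fieldRange (IntermediateField.adjoin
          (frobenius K 2).fieldRange (σ.valueSpace.map (LinearMap.mulLeft _ s⁻¹) : Set K))) := by
  have hdim := haniso.finrank_valueSpace
  rcases hσ with h | ⟨n, a, c, hc, hsub, hlt, hcodim⟩ | ⟨-, hmin⟩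
  · obtain ⟨Q, hQ⟩ := h.exists_intermediateField
    have hfin : FiniteDimensional (frobenius K 2).fieldRange
        (Subalgebra.toSubmodule Q.toSubalgebra) := by rw [hQ]; infer_instance
    have hfin' : FiniteDimensional (frobenius K 2).fieldRange Q := hfin
    have hQdim : finrank (frobenius K 2).fieldRange Q =
        finrank (frobenius K 2).fieldRange σ.valueSpace := by rw [← hQ]; rfl
    have hpos : 0 < finrank (frobenius K 2).fieldRange Q := finrank_pos
    refine ⟨by omega, Or.inl ⟨Q, 1, hfin', one_ne_zero, fun s hs => ⟨s, ?_, mul_one s⟩,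
      by omega, by omega⟩⟩
    rw [← hQ] at hs
    exact hs
  · obtain ⟨Q, hQ⟩ := exists_intermediateField_eq_valueSpace_pfister a
    have hfin : FiniteDimensional (frobenius K 2).fieldRange
        (Subalgebra.toSubmodule Q.toSubalgebra) := by rw [hQ]; infer_instance
    have hfin' : FiniteDimensional (frobenius K 2).fieldRange Q := hfin
    have hQdim : finrank (frobenius K 2).fieldRange Q =
        finrank (frobenius K 2).fieldRange (pfister a).valueSpace := by rw [← hQ]; rfl
    -- The ambient quasi-Pfister form may be isotropic, so only dim Q ≤ 2^n is available; this
    -- suffices.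
    have hpf := (pfister a).finrank_eq_defect_add_finrank_valueSpace
    rw [finrank_fintype_fun_eq_card, Fintype.card_fun, Fintype.card_fin, Fintype.card_fin] at hpf
    have h0 : 0 < 2 ^ n := by positivity
    refine ⟨by omega, Or.inl ⟨Q, c⁻¹, hfin', inv_ne_zero hc, fun s hs => ⟨c * s, ?_, ?_⟩,
      by omega, by omega⟩⟩
    · have h := hsub.valueSpace_le
      rw [valueSpace_smul, ← hQ] at h
      exact h ⟨s, hs, rfl⟩
    · field_simp
  · have hpos : finrank K S ≠ 0 := by
      intro h0
      rw [h0] at hmin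
      omega
    refine ⟨by omega, Or.inr ?_⟩
    have hne : σ.valueSpace ≠ ⊥ := by
      intro h0
      rw [h0, finrank_bot] at hdim
      omega
    obtain ⟨s, hs, hs0⟩ := (Submodule.ne_bot_iff _).1 hne
    refine ⟨s, hs, hs0, ?_⟩
    have := σ.normDegree_le_finrank_adjoin hs hs0
    rw [hdim]
    omega

end Special

variable {F : Type u} [Field F] [CharP F 2]
variable {V : Type v} [AddCommGroup V] [Module F V] [FiniteDimensional F V]
variable {W : Type w} [AddCommGroup W] [Module F W] [FiniteDimensional F W]

theorem VishikEquivalent.finrank_span_valueSpace_eq {φ : TSForm F V} {ψ : TSForm F W}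
    (h : VishikEquivalent φ ψ) (K : Type x) [Field K] [Algebra F K] [CharP K 2] [Small.{u} K]
    (M : IntermediateField (frobenius K 2).fieldRange K) :
    finrank M (span M ((φ.baseChange K).valueSpace : Set K)) =
      finrank M (span M ((ψ.baseChange K).valueSpace : Set K)) := by
  rw [valueSpace_baseChange, valueSpace_baseChange, span_span_of_tower, span_span_of_tower]
  have : Small.{u} M := small_of_injective (f := (Subtype.val : M → K)) Subtype.val_injective
  exact h.finrank_span_eq M fun a => by
    obtain ⟨y, hy⟩ := exists_algebraMap_eq_sq (algebraMap F K a)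
    exact ⟨algebraMap _ M y, by rw [← hy]; rfl⟩

theorem VishikEquivalent.finrank_valueSpace_eq {φ : TSForm F V} {ψ : TSForm F W}
    (h : VishikEquivalent φ ψ) (K : Type x) [Field K] [Algebra F K] [CharP K 2] [Small.{u} K] :
    finrank (frobenius K 2).fieldRange (φ.baseChange K).valueSpace =
      finrank (frobenius K 2).fieldRange (ψ.baseChange K).valueSpace := by
  rw [valueSpace_baseChange, valueSpace_baseChange]
  have : Small.{u} (frobenius K 2).fieldRange :=
    small_of_injective (f := (Subtype.val : (frobenius K 2).fieldRange → K)) Subtype.val_injective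
  exact h.finrank_span_eq _ fun a => exists_algebraMap_eq_sq _

/-! ### Descent of similarity from K to F -/

section Descent

variable (K : Type x) [Field K] [Algebra F K] [CharP K 2]

omit [FiniteDimensional F V] in
theorem mem_span_range_algebraMap (φ : TSForm F V) (a : K) :
    a ∈ span ((frobenius K 2).comp (algebraMap F K)).fieldRange
      (Set.range fun v => algebraMap F K (φ v)) ↔ ∃ v, algebraMap F K (φ v) = a := by
  constructor
  · intro ha
    induction ha using span_induction with
    | zero => exact ⟨0, by simp⟩
    | add x y _ _ hx hy =>
      obtain ⟨v, rfl⟩ := hx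
      obtain ⟨w, rfl⟩ := hy
      exact ⟨v + w, by simp⟩
    | smul c x _ hx =>
      obtain ⟨v, rfl⟩ := hx
      obtain ⟨_, d, rfl⟩ := c
      exact ⟨d • v, by rw [apply_smul, map_mul, map_pow]; rfl⟩
    | mem x hx => exact hx
  · rintro ⟨v, rfl⟩
    exact subset_span ⟨v, rfl⟩

theorem finiteDimensional_span_range_algebraMap (φ : TSForm F V) :
    FiniteDimensional ((frobenius K 2).comp (algebraMap F K)).fieldRange
      (span ((frobenius K 2).comp (algebraMap F K)).fieldRange
        (Set.range fun v => algebraMap F K (φ v))) := by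
  let g : V →ₛₗ[(((frobenius K 2).comp (algebraMap F K)).rangeRestrictFieldEquiv :
      F →+* ((frobenius K 2).comp (algebraMap F K)).fieldRange)]
      (span ((frobenius K 2).comp (algebraMap F K)).fieldRange
        (Set.range fun v => algebraMap F K (φ v))) :=
    { toFun := fun v => ⟨algebraMap F K (φ v), subset_span ⟨v, rfl⟩⟩
      map_add' := fun v w => Subtype.ext (by simp)
      map_smul' := fun a v => Subtype.ext (by
        change algebraMap F K (φ (a • v)) = algebraMap F K a ^ 2 * algebraMap F K (φ v)
        rw [apply_smul, map_mul, map_pow]) }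
  have : RingHomSurjective (((frobenius K 2).comp (algebraMap F K)).rangeRestrictFieldEquiv :
      F →+* ((frobenius K 2).comp (algebraMap F K)).fieldRange) :=
    ⟨((frobenius K 2).comp (algebraMap F K)).rangeRestrictFieldEquiv.surjective⟩
  refine Module.Finite.of_surjective g ?_
  rintro ⟨a, ha⟩
  obtain ⟨v, rfl⟩ := (mem_span_range_algebraMap K φ a).1 ha
  exact ⟨v, rfl⟩

/-- Similarity descends from `K` to `F` if `K² = G_F(φ)`. -/
theorem VishikEquivalent.similar_of_baseChange {φ : TSForm F V} {ψ : TSForm F W}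
    (h : VishikEquivalent φ ψ)
    (hK : Set.range (fun z : K => z ^ 2) = algebraMap F K '' φ.similarityFactors)
    (hne : (φ.baseChange K).valueSpace ≠ ⊥) {q : K} (hq : q ≠ 0)
    (hmap : (φ.baseChange K).valueSpace.map (LinearMap.mulLeft _ q) =
      (ψ.baseChange K).valueSpace) : Similar φ ψ := by
  have hsmall : Small.{u} K := small_of_sq_mem hK
  have hsmall₀ : Small.{u} ((frobenius K 2).comp (algebraMap F K)).fieldRange :=
    small_of_injective (f := (Subtype.val : _ → K)) Subtype.val_injective
  have hdim := h.finrank_span_eq (K := K) ((frobenius K 2).comp (algebraMap F K)).fieldRange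
    fun a => ⟨⟨algebraMap F K a ^ 2, a, rfl⟩, rfl⟩
  have hφ₀ := mem_span_range_algebraMap K φ
  have hψ₀ := mem_span_range_algebraMap K ψ
  have hfin := finiteDimensional_span_range_algebraMap K φ
  set A := span ((frobenius K 2).comp (algebraMap F K)).fieldRange
    (Set.range fun v => algebraMap F K (φ v))
  set B := span ((frobenius K 2).comp (algebraMap F K)).fieldRange
    (Set.range fun v => algebraMap F K (ψ v))
  have hφK := φ.mem_valueSpace_baseChange_iff hK
  -- Values of ψ lie in q·D(φ_K) = q·D(φ), as φ gains no values over K. The inclusion is an equality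
  -- because the dimensions over F² agree.
  have hBA : B = A.map (LinearMap.mulLeft _ q) := by
    refine Submodule.eq_of_le_of_finrank_eq (fun a ha => ?_)
      (by rw [finrank_map_mulLeft A hq, hdim])
    obtain ⟨w, rfl⟩ := (hψ₀ a).1 ha
    have hw : algebraMap F K (ψ w) ∈ (ψ.baseChange K).valueSpace :=
      ⟨1 ⊗ₜ w, by rw [baseChange_tmul]; simp⟩
    rw [← hmap] at hw
    obtain ⟨s, hs, hsw⟩ := hw
    exact ⟨s, (hφ₀ s).2 ((hφK s).1 hs), hsw⟩
  have hψφ : ∀ v, ∃ w, algebraMap F K (ψ w) = q * algebraMap F K (φ v) := fun v =>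
    (hψ₀ _).1 (by rw [hBA]; exact ⟨_, (hφ₀ _).2 ⟨v, rfl⟩, rfl⟩)
  obtain ⟨a, ha, ha0⟩ := (Submodule.ne_bot_iff _).1 hne
  obtain ⟨v₀, rfl⟩ := (hφK a).1 ha
  obtain ⟨w₀, hw₀⟩ := hψφ v₀
  -- The scalar q is a quotient of a value of ψ by a value of φ, hence lies in F.
  obtain ⟨r, hr⟩ : ∃ r, algebraMap F K r = q :=
    ⟨ψ w₀ / φ v₀, by rw [map_div₀, hw₀, mul_div_cancel_right₀ _ ha0]⟩
  have hr0 : r ≠ 0 := fun h0 => hq (by rw [← hr, h0, map_zero])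
  have hinj := (algebraMap F K).injective
  refine ⟨r⁻¹, inv_ne_zero hr0, isometric_of_valueSpace_eq h.1 ?_⟩
  rw [valueSpace_smul]
  ext a
  rw [mem_map_mulLeft, mem_valueSpace]
  constructor
  · rintro ⟨v, rfl⟩
    obtain ⟨w, hw⟩ := hψφ v
    refine ⟨ψ w, ⟨w, rfl⟩, ?_⟩
    rw [inv_mul_eq_iff_eq_mul₀ hr0]
    exact hinj (by rw [hw, map_mul, hr])
  · rintro ⟨_, ⟨w, rfl⟩, rfl⟩
    have hw : algebraMap F K (ψ w) ∈ A.map (LinearMap.mulLeft _ q) := by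
      rw [← hBA]; exact (hψ₀ _).2 ⟨w, rfl⟩
    obtain ⟨s, hs, hsw⟩ := hw
    obtain ⟨v, rfl⟩ := (hφ₀ s).1 hs
    refine ⟨v, ?_⟩
    rw [eq_inv_mul_iff_mul_eq₀ hr0]
    exact hinj (by rw [map_mul, hr]; exact hsw)

end Descent

/-! ### Assembly of the proof -/

theorem VishikEquivalent.similar_of_special {φ : TSForm F V} {ψ : TSForm F W}
    (hφψ : VishikEquivalent φ ψ) (K : Type x) [Field K] [Algebra F K] [CharP K 2]
    (hK : Set.range (fun z : K => z ^ 2) = algebraMap F K '' φ.similarityFactors)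
    {P : Type y} [AddCommGroup P] [Module K P] [FiniteDimensional K P]
    {S : Type z} [AddCommGroup S] [Module K S] [FiniteDimensional K S]
    {π : TSForm K P} {b : K} {σ : TSForm K S}
    (hspecial : IsSpecialQuasiPfisterNeighbor (φ.baseChange K).anisotropicPart π b σ)
    {c : K} (hc : c ≠ 0) (hcπ : IsSubform (c • π) (ψ.baseChange K))
    (hσ : σ.IsQuasiPfister ∨ σ.IsQuasiPfisterNeighborOfCodim 1 ∨ σ.IsMinimal) :
    Similar φ ψ := by
  have hsmall : Small.{u} K := small_of_sq_mem hK
  obtain ⟨hπ, hb0, hσπ, d, hd, hsim⟩ := hspecial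
  obtain ⟨Q, hQ⟩ := hπ.exists_intermediateField
  have hQfin : FiniteDimensional (frobenius K 2).fieldRange
      (Subalgebra.toSubmodule Q.toSubalgebra) := by rw [hQ]; infer_instance
  have hQfin' : FiniteDimensional (frobenius K 2).fieldRange Q := hQfin
  have haniso : (orthSum π (b • σ)).Anisotropic := by
    obtain ⟨f, hf⟩ := hsim
    intro t ht
    have h := hf (f.symm t)
    rw [f.apply_symm_apply, LinearMap.smul_apply, ht, smul_zero] at h
    simpa using anisotropic_anisotropicPart _ _ h
  have hσaniso : σ.Anisotropic := fun s hs => by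
    have h := haniso (0, s) (by simp [orthSum, hs])
    exact congrArg Prod.snd h
  have hA : (φ.baseChange K).valueSpace = (Subalgebra.toSubmodule Q.toSubalgebra ⊔
      σ.valueSpace.map (LinearMap.mulLeft _ b)).map (LinearMap.mulLeft _ d) := by
    rw [← valueSpace_anisotropicPart, hsim.valueSpace_eq, valueSpace_smul, valueSpace_orthSum,
      valueSpace_smul, hQ]
  have hSQ : ∀ s ∈ σ.valueSpace, s ∈ Q := fun s hs => by
    have h := hσπ.valueSpace_le hs
    rw [← hQ] at h
    exact h
  obtain ⟨hpos, hcases⟩ := finrank_pos_and_valueSpace_cases hσaniso hσ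
  -- If b ∈ Q, then bσ(s) is also a value of π for some σ(s) ≠ 0. In characteristic 2 this gives a
  -- nontrivial zero of the anisotropic form π ⊥ bσ.
  have hbQ : b ∉ Q := fun hb => by
    have hne : σ.valueSpace ≠ ⊥ := fun h0 => by
      have h := hσaniso.finrank_valueSpace
      rw [h0, finrank_bot] at h
      omega
    obtain ⟨_, ⟨s, rfl⟩, hs0⟩ := (Submodule.ne_bot_iff _).1 hne
    have h : b * σ s ∈ Subalgebra.toSubmodule Q.toSubalgebra :=
      (mul_mem hb (hSQ _ ⟨s, rfl⟩) : b * σ s ∈ Q)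
    rw [hQ] at h
    obtain ⟨t, ht⟩ := h
    have h0 := haniso (t, s) (by
      change π t + b * σ s = 0
      rw [ht, CharTwo.add_self_eq_zero])
    refine hs0 ?_
    rw [show s = 0 from congrArg Prod.snd h0, map_zero]
  have hcinv := inv_ne_zero hc
  have hQB : ∀ t ∈ Q, t ∈ (ψ.baseChange K).valueSpace.map (LinearMap.mulLeft _ c⁻¹) := by
    intro t ht
    have ht' : t ∈ π.valueSpace := by rw [← hQ]; exact ht
    have h := hcπ.valueSpace_le
    rw [valueSpace_smul] at h
    exact ⟨c * t, h ⟨t, ht', rfl⟩, by simp [hc]⟩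
  have hdimK := hφψ.finrank_valueSpace_eq K
  have hVK := hφψ.finrank_span_valueSpace_eq K
  rw [hA, finrank_map_mulLeft _ hd] at hdimK
  obtain ⟨p, hp0, hp⟩ := exists_map_mulLeft_eq_of_special exists_algebraMap_eq_sq
    ((ψ.baseChange K).valueSpace.map (LinearMap.mulLeft _ c⁻¹)) Q σ.valueSpace hSQ hbQ hQB
    (by rw [hdimK, finrank_map_mulLeft _ hcinv])
    (fun M => by
      rw [finrank_span_map_mulLeft _ _ hcinv, ← hVK, hA, finrank_span_map_mulLeft _ _ hd]) hcases
  -- d⁻¹ normalizes D(φ_K) to P + bS, p carries this to c⁻¹D(ψ_K), and c undoes the last scaling.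
  refine hφψ.similar_of_baseChange K hK ?_ (q := c * p * d⁻¹)
    (mul_ne_zero (mul_ne_zero hc hp0) (inv_ne_zero hd)) ?_
  · rw [hA]
    exact (Submodule.ne_bot_iff _).2
      ⟨d, ⟨1, mem_sup_left (one_mem Q), by simp⟩, hd⟩
  · rw [hA, map_mulLeft_mulLeft, mul_assoc, mul_assoc, inv_mul_cancel₀ hd, mul_one,
      ← map_mulLeft_mulLeft, hp, map_mulLeft_mulLeft, mul_inv_cancel₀ hc, LinearMap.mulLeft_one,
      Submodule.map_id]

end TSForm

end

theorem mainTheorem4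
    {F : Type u} [Field F] [CharP F 2]
    {V : Type v} [AddCommGroup V] [Module F V] [FiniteDimensional F V]
    {W : Type w} [AddCommGroup W] [Module F W] [FiniteDimensional F W]
    (φ : TSForm F V) (ψ : TSForm F W)
    (hφψ : TSForm.VishikEquivalent φ ψ)
    (K : Type x) [Field K] [Algebra F K] [CharP K 2]
    (hK : Set.range (fun z : K => z ^ 2) = algebraMap F K '' φ.similarityFactors)
    {P : Type y} [AddCommGroup P] [Module K P] [FiniteDimensional K P]
    {S : Type z} [AddCommGroup S] [Module K S] [FiniteDimensional K S]
    (π : TSForm K P) (b : K) (σ : TSForm K S)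
    (hspecial : TSForm.IsSpecialQuasiPfisterNeighbor (φ.baseChange K).anisotropicPart π b σ)
    (c : K) (hc : c ≠ 0) (hcπ : TSForm.IsSubform (c • π) (ψ.baseChange K))
    (hσ : σ.IsQuasiPfister ∨ σ.IsQuasiPfisterNeighborOfCodim 1 ∨ σ.IsMinimal) :
    TSForm.Similar φ ψ :=
  hφψ.similar_of_special K hK hspecial hc hcπ hσ
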